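/- Let ${\bf k}$ be a field of characteristic $0$, $P$ a ${\bf k}[\partial]$-module, $V[\lambda]$ the polynomials in $\lambda$ with coefficients in $V$, $\tau$ the flip, $\partial^{\otimes 2}=\partial\otimes I+I\otimes\partial$ (the action of $\partial$ on a tensor square), and ${\bf K}={\bf k}[[h]]$. For a bilinear product $a_\lambda b\in P[\lambda]$ on $P$, the polynomial $b_{-\lambda-\partial}a$ is obtained from $b_\mu a=\sum_n\mu^n c_n$ as $\sum_n(-\lambda-\partial)^n c_n$, and the subscript $-\lambda-\partial^{\otimes2}$ is understood in the same way, with $\partial^{\otimes 2}$ acting on coefficients in $P\otimes P$. Put $\mathfrak L(a)_\lambda b=a_\lambda b$, $\mathfrak R(a)_\lambda b=b_{-\lambda-\partial}a$ and, for a bracket, $\mathfrak{ad}(a)_\lambda b=[a_\lambda b]$. **Definitions.** All of the following are meant over ${\bf k}$ and, with ${\bf K}$-linear maps and $\otimes_{\bf K}$, also for ${\bf K}$-modules with a ${\bf K}$-linear endomorphism $\partial$. A product (or bracket) is *sesquilinear* if $(\partial a)_\lambda b=-\lambda a_\lambda b$ and $a_\lambda(\partial b)=(\partial+\lambda)a_\lambda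 b$. * An *associative conformal algebra* is a sesquilinear bilinear product $P\times P\to P[\lambda]$ with $(a_\lambda b)_{\lambda+\mu}c=a_\lambda(b_\mu c)$; it is *commutative* if $a_\lambda b=b_{-\lambda-\partial}a$. A *Lie conformal algebra* is a sesquilinear bilinear bracket with $[a_\lambda b]=-[b_{-\lambda-\partial}a]$ and $[a_\lambda[b_\mu c]]=[[a_\lambda b]_{\lambda+\mu}c]+[b_\mu[a_\lambda c]]$. A *Poisson conformal algebra* is a Lie conformal algebra with a commutative associative conformal product such that $[a_\lambda(b_\mu c)]=[a_\lambda b]_{\lambda+\mu}c+b_\mu[a_\lambda c]$. * An *associative conformal coalgebra* is a ${\bf k}[\partial]$-homomorphism $\Delta:P\to P\otimes P$ with $(I\otimes\Delta)\Delta=(\Delta\otimes I)\Delta$; it is *cocommutative* if $\Delta=\tau\Delta$. A *Lie conformal coalgebra* is a ${\bf k}[\partial]$-homomorphism $\delta:P\to P\otimes P$ with $\delta=-\tau\delta$ and $(I\otimes\delta)\delta-(\tau\otimes I)(I\otimes\delta)\delta=(\delta\otimes I)\delta$. A *Poisson conformal coalgebra* $(P,\delta,\Delta)$ consists of a Lie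 conformal coalgebra and a cocommutative associative conformal coalgebra with $(I\otimes\Delta)\delta=(\delta\otimes I)\Delta+(\tau\otimes I)(I\otimes\delta)\Delta$. * An *ASI conformal bialgebra* $(P,\cdot_\lambda\cdot,\Delta)$ is an associative conformal algebra and coalgebra such that $$\Delta(a_\lambda b)=(I\otimes\mathfrak L(a)_\lambda)\Delta(b)+(\mathfrak R(b)_{-\lambda-\partial^{\otimes2}}\otimes I)\Delta(a),$$ $$(\mathfrak L(b)_{-\lambda-\partial^{\otimes2}}\otimes I-I\otimes\mathfrak R(b)_{-\lambda-\partial^{\otimes2}})\Delta(a)+\tau(\mathfrak L(a)_\lambda\otimes I-I\otimes\mathfrak R(a)_\lambda)\Delta(b)=0;$$ it is *commutative and cocommutative* if its product is commutative and its coproduct cocommutative. * A *Lie conformal bialgebra* $(P,[\cdot_\lambda\cdot],\delta)$ is a Lie conformal algebra and coalgebra with $$\delta([a_\lambda b])=(\mathfrak{ad}(a)_\lambda\otimes I+I\otimes\mathfrak{ad}(a)_\lambda)\delta(b)-(\mathfrak{ad}(b)_{-\lambda-\partial^{\otimes2}}\otimes I+I\otimes\mathfrak{ad}(b)_{-\lambda-\partial^{\otimes2}})\delta(a).$$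 * A *Poisson conformal bialgebra* $(P,[\cdot_\lambda\cdot],\cdot_\lambda\cdot,\delta,\Delta)$ is such that $(P,[\cdot_\lambda\cdot],\cdot_\lambda\cdot)$ is a Poisson conformal algebra, $(P,\delta,\Delta)$ a Poisson conformal coalgebra, $(P,[\cdot_\lambda\cdot],\delta)$ a Lie conformal bialgebra, $(P,\cdot_\lambda\cdot,\Delta)$ a commutative and cocommutative ASI conformal bialgebra, and $$\delta(a_\lambda b)=(\mathfrak L(a)_\lambda\otimes I)\delta(b)+(\mathfrak L(b)_{-\lambda-\partial^{\otimes2}}\otimes I)\delta(a)+(I\otimes\mathfrak{ad}(a)_\lambda)\Delta(b)+(I\otimes\mathfrak{ad}(b)_{-\lambda-\partial^{\otimes2}})\Delta(a),$$ $$\Delta([a_\lambda b])=(\mathfrak{ad}(a)_\lambda\otimes I+I\otimes\mathfrak{ad}(a)_\lambda)\Delta(b)-(I\otimes\mathfrak L(b)_{-\lambda-\partial^{\otimes2}})\delta(a)+(\mathfrak L(b)_{-\lambda-\partial^{\otimes2}}\otimes I)\delta(a).$$ Let $P[[h]]$ carry the coefficientwise action of $\partial$ and the $h$-adic topology, and let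 $P[[h]]\widehat\otimes P[[h]]$ be the $h$-adic completion of $P[[h]]\otimes_{\bf K}P[[h]]$. A *conformal formal deformation* of a commutative and cocommutative ASI conformal bialgebra $(P,\cdot_\lambda\cdot,\Delta)$ consists of a (continuous) ${\bf K}$-bilinear product $\circ^h_\lambda:P[[h]]\times P[[h]]\to P[[h]][[\lambda]]$ and a (continuous) ${\bf K}$-linear ${\bf k}[\partial]$-homomorphism $\Delta_h:P[[h]]\to P[[h]]\widehat\otimes P[[h]]$, coassociative in the completed triple tensor product, such that for every $n\in\mathbb N$ they induce on $P[[h]]/h^nP[[h]]$ the structure of an ASI conformal bialgebra over ${\bf K}$ (in particular, the induced product is polynomial in $\lambda$), and such that for $a,b\in P$ $$a\circ^h_\lambda b=a_\lambda b+\sum_{i\ge1}h^i\{a_\lambda b\}_{\mu_i},\qquad \Delta_h(a)=\Delta(a)+\sum_{i\ge1}\Delta_i(a)h^i,$$ with ${\bf k}$-bilinear maps $\{\cdot_\lambda\cdot\}_{\mu_i}:P\times P\to P[\lambda]$ and ${\bf k}[\partial]$-homomorphisms $\Delta_i:P\to P\otimes P$. **Theorem (semi-classical limit).** Let $(P[[h]],\circ^h_\lambda,\Delta_h)$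 be a conformal formal deformation of a commutative and cocommutative ASI conformal bialgebra $(P,\cdot_\lambda\cdot,\Delta)$. For $a,b\in P$ put $$[a_\lambda b]=\{a_\lambda b\}_{\mu_1}-\{b_{-\lambda-\partial}a\}_{\mu_1},\qquad \delta(a)=\Delta_1(a)-\tau\Delta_1(a).$$ Then $(P,[\cdot_\lambda\cdot],\cdot_\lambda\cdot,\delta,\Delta)$ is a Poisson conformal bialgebra. -/

import Mathlib

open scoped TensorProduct PowerSeries

namespace Conformal

noncomputable section

/-! ## Polynomials in `λ` with coefficients in a module

Everything is stated over a commutative ring `R`, since conformal algebras over `k` and their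
`k[[h]]`-linear analogues are both needed. A module over `R[∂]` is an `R`-module `M` together
with an `R`-linear endomorphism `D`, the action of `∂`. -/

section Polynomials

variable {R : Type*} [CommRing R] {V W : Type*} [AddCommGroup V] [Module R V]
  [AddCommGroup W] [Module R W]

/-- `V[λ]`: the finitely supported function `p` stands for `∑ λ ^ n • p n`. -/
abbrev Poly (V : Type*) [AddCommGroup V] : Type _ := ℕ →₀ V

variable (R) in
/-- The inclusion of the constants, `V → V[λ]`. -/
def const (V : Type*) [AddCommGroup V] [Module R V] : V →ₗ[R] Poly V := Finsupp.lsingle 0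

variable (R) in
/-- Multiplication by the variable `λ` on `V[λ]`. -/
def lam (V : Type*) [AddCommGroup V] [Module R V] : Module.End R (Poly V) :=
  Finsupp.lmapDomain V R Nat.succ

/-- The coefficientwise extension `V[λ] → W[λ]` of a linear map `V → W`. -/
def coeffwise (f : V →ₗ[R] W) : Poly V →ₗ[R] Poly W := Finsupp.mapRange.linearMap f

/-- Substitution `λ := T` followed by a linear map on coefficients:
`∑ λ ^ n • v n ↦ ∑ T ^ n (f (v n))`, where `T` is an endomorphism of `W`. -/
def subst (f : V →ₗ[R] W) (T : Module.End R W) : Poly V →ₗ[R] W :=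
  Finsupp.lsum R fun n => (T ^ n) ∘ₗ f

/-- The substitution `λ := -λ - D` on `V[λ]`, where `D` acts on the coefficients from the left:
`∑ λ ^ n • v n ↦ ∑ (-λ - D) ^ n (v n)`. -/
def reflect (D : Module.End R V) : Module.End R (Poly V) :=
  subst (const R V) (-lam R V - coeffwise D)

/-- For `f = f_λ : V → W[λ]`, the map `f_λ ⊗ I : V ⊗ U → (W ⊗ U)[λ]`. -/
def tensorRight {U : Type*} [AddCommGroup U] [Module R U] (f : V →ₗ[R] Poly W) :
    V ⊗[R] U →ₗ[R] Poly (W ⊗[R] U) :=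
  (TensorProduct.finsuppLeft R R W U ℕ).toLinearMap ∘ₗ f.rTensor U

/-- For `f = f_λ : V → W[λ]`, the map `I ⊗ f_λ : U ⊗ V → (U ⊗ W)[λ]`. -/
def tensorLeft {U : Type*} [AddCommGroup U] [Module R U] (f : V →ₗ[R] Poly W) :
    U ⊗[R] V →ₗ[R] Poly (U ⊗[R] W) :=
  (TensorProduct.finsuppRight R R U W ℕ).toLinearMap ∘ₗ f.lTensor U

/-- `V[λ, μ]`, with `λ` the inner and `μ` the outer variable. -/
abbrev Poly₂ (V : Type*) [AddCommGroup V] : Type _ := Poly (Poly V)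

variable (R) in
/-- The inclusion of the constants, `V → V[λ, μ]`. -/
def const₂ (V : Type*) [AddCommGroup V] [Module R V] : V →ₗ[R] Poly₂ V :=
  const R (Poly V) ∘ₗ const R V

variable (R) in
/-- Multiplication by `λ` on `V[λ, μ]`. -/
def lam₂ (V : Type*) [AddCommGroup V] [Module R V] : Module.End R (Poly₂ V) :=
  coeffwise (lam R V)

variable (R) in
/-- Multiplication by `μ` on `V[λ, μ]`. -/
def mu₂ (V : Type*) [AddCommGroup V] [Module R V] : Module.End R (Poly₂ V) := lam R (Poly V)

end Polynomials

/-! ## Conformal algebras, coalgebras and bialgebras -/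

section Algebras

variable {R : Type*} [CommRing R] {M : Type*} [AddCommGroup M] [Module R M]

/-- `R`-bilinear maps `M × M → M[λ]`, written `(a, b) ↦ a_λ b`. -/
abbrev LambdaProduct (R : Type*) [CommRing R] (M : Type*) [AddCommGroup M] [Module R M] : Type _ :=
  M →ₗ[R] M →ₗ[R] Poly M

/-- `a_(λ+μ) c` in `M[λ, μ]`, as a linear function of `a`. -/
def LambdaProduct.atSum (m : LambdaProduct R M) (c : M) : M →ₗ[R] Poly₂ M :=
  subst (const₂ R M) (lam₂ R M + mu₂ R M) ∘ₗ m.flip c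

/-- `a_λ c` in `M[λ, μ]`, as a linear function of `c`. -/
def LambdaProduct.atLam (m : LambdaProduct R M) (a : M) : M →ₗ[R] Poly₂ M :=
  subst (const₂ R M) (lam₂ R M) ∘ₗ m a

/-- `a_μ c` in `M[λ, μ]`, as a linear function of `c`. -/
def LambdaProduct.atMu (m : LambdaProduct R M) (a : M) : M →ₗ[R] Poly₂ M :=
  subst (const₂ R M) (mu₂ R M) ∘ₗ m a

/-- `(a_λ b)_(λ+μ) c`: the outer product is `m`, the inner one `m'`. -/
def leftNested (m m' : LambdaProduct R M) (a b c : M) : Poly₂ M :=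
  subst (m.atSum c) (lam₂ R M) (m' a b)

/-- `a_λ (b_μ c)`: the outer product is `m`, the inner one `m'`. -/
def rightNested (m m' : LambdaProduct R M) (a b c : M) : Poly₂ M :=
  subst (m.atLam a) (mu₂ R M) (m' b c)

/-- `b_μ (a_λ c)`: the outer product is `m`, the inner one `m'`. -/
def rightNestedSwap (m m' : LambdaProduct R M) (a b c : M) : Poly₂ M :=
  subst (m.atMu b) (lam₂ R M) (m' a c)

/-- Conformal sesquilinearity: `(∂a)_λ b = -λ a_λ b` and `a_λ (∂b) = (∂ + λ) a_λ b`. -/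
structure IsSesquilinear (D : Module.End R M) (m : LambdaProduct R M) : Prop where
  left : ∀ a b, m (D a) b = -lam R M (m a b)
  right : ∀ a b, m a (D b) = (coeffwise D + lam R M) (m a b)

/-- `b_{-λ-∂} a`. -/
def opposite (D : Module.End R M) (m : LambdaProduct R M) : LambdaProduct R M :=
  m.flip.compr₂ (reflect D)

/-- Associative conformal algebras. -/
structure IsAssocAlgebra (D : Module.End R M) (m : LambdaProduct R M) : Prop where
  sesquilinear : IsSesquilinear D m
  /-- `(a_λ b)_(λ+μ) c = a_λ (b_μ c)` -/
  assoc : ∀ a b c, leftNested m m a b c = rightNested m m a b c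

/-- Commutativity: `a_λ b = b_{-λ-∂} a`. -/
def IsCommutative (D : Module.End R M) (m : LambdaProduct R M) : Prop :=
  ∀ a b, m a b = opposite D m a b

/-- Lie conformal algebras. -/
structure IsLieAlgebra (D : Module.End R M) (br : LambdaProduct R M) : Prop where
  sesquilinear : IsSesquilinear D br
  /-- `[a_λ b] = -[b_{-λ-∂} a]` -/
  skew : ∀ a b, br a b = -opposite D br a b
  /-- `[a_λ [b_μ c]] = [[a_λ b]_(λ+μ) c] + [b_μ [a_λ c]]` -/
  jacobi : ∀ a b c,
    rightNested br br a b c = leftNested br br a b c + rightNestedSwap br br a b c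

/-- Poisson conformal algebras. -/
structure IsPoissonAlgebra (D : Module.End R M) (br m : LambdaProduct R M) : Prop where
  lie : IsLieAlgebra D br
  assoc : IsAssocAlgebra D m
  comm : IsCommutative D m
  /-- `[a_λ (b_μ c)] = [a_λ b]_(λ+μ) c + b_μ [a_λ c]` -/
  leibniz : ∀ a b c,
    rightNested br m a b c = leftNested m br a b c + rightNestedSwap m br a b c

/-- `∂^{⊗2} = ∂ ⊗ I + I ⊗ ∂`, the action of `∂` on `M ⊗ M`. -/
def derTensor (D : Module.End R M) : Module.End R (M ⊗[R] M) :=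
  D.rTensor M + D.lTensor M

variable (R M) in
/-- The flip `τ`. -/
def flip : Module.End R (M ⊗[R] M) := (TensorProduct.comm R M M).toLinearMap

variable (R M) in
/-- `τ ⊗ I` on `M ⊗ M ⊗ M`. -/
def flipLeft : Module.End R (M ⊗[R] (M ⊗[R] M)) :=
  (TensorProduct.leftComm R M M M).toLinearMap

/-- `(f ⊗ I) ∘ g : M → M ⊗ M ⊗ M`. -/
def coLeft (f g : M →ₗ[R] M ⊗[R] M) : M →ₗ[R] M ⊗[R] (M ⊗[R] M) :=
  (TensorProduct.assoc R M M M).toLinearMap ∘ₗ f.rTensor M ∘ₗ g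

/-- `(I ⊗ f) ∘ g : M → M ⊗ M ⊗ M`. -/
def coRight (f g : M →ₗ[R] M ⊗[R] M) : M →ₗ[R] M ⊗[R] (M ⊗[R] M) :=
  f.lTensor M ∘ₗ g

/-- `f : M → M ⊗ M` is a homomorphism of `R[∂]`-modules. -/
def IsDerHom (D : Module.End R M) (f : M →ₗ[R] M ⊗[R] M) : Prop :=
  ∀ a, f (D a) = derTensor D (f a)

/-- Associative conformal coalgebras. -/
structure IsAssocCoalgebra (D : Module.End R M) (Δ : M →ₗ[R] M ⊗[R] M) : Prop where
  hom : IsDerHom D Δ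
  coassoc : ∀ a, coRight Δ Δ a = coLeft Δ Δ a

/-- Cocommutativity: `Δ = τ Δ`. -/
def IsCocommutative (Δ : M →ₗ[R] M ⊗[R] M) : Prop := ∀ a, Δ a = flip R M (Δ a)

/-- Lie conformal coalgebras. -/
structure IsLieCoalgebra (D : Module.End R M) (δ : M →ₗ[R] M ⊗[R] M) : Prop where
  hom : IsDerHom D δ
  skew : ∀ a, δ a = -flip R M (δ a)
  /-- `(I ⊗ δ) δ - (τ ⊗ I) (I ⊗ δ) δ = (δ ⊗ I) δ` -/
  jacobi : ∀ a, coRight δ δ a - flipLeft R M (coRight δ δ a) = coLeft δ δ a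

/-- Poisson conformal coalgebras. -/
structure IsPoissonCoalgebra (D : Module.End R M) (δ Δ : M →ₗ[R] M ⊗[R] M) : Prop where
  lie : IsLieCoalgebra D δ
  coassoc : IsAssocCoalgebra D Δ
  cocomm : IsCocommutative Δ
  /-- `(I ⊗ Δ) δ = (δ ⊗ I) Δ + (τ ⊗ I) (I ⊗ δ) Δ` -/
  compat : ∀ a, coRight Δ δ a = coLeft δ Δ a + flipLeft R M (coRight δ Δ a)

/-- `L(a)_λ b = a_λ b`; for a bracket this is `ad(a)_λ`. -/
def L (m : LambdaProduct R M) (a : M) : M →ₗ[R] Poly M := m a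

/-- `R(a)_λ b = b_{-λ-∂} a`. -/
def Rt (D : Module.End R M) (m : LambdaProduct R M) (a : M) : M →ₗ[R] Poly M := opposite D m a

/-- Antisymmetric infinitesimal (ASI) conformal bialgebras. The substitution
`λ := -λ - ∂^{⊗2}` is `reflect (derTensor D)`. -/
structure IsASIBialgebra (D : Module.End R M) (m : LambdaProduct R M)
    (Δ : M →ₗ[R] M ⊗[R] M) : Prop where
  assoc : IsAssocAlgebra D m
  coassoc : IsAssocCoalgebra D Δ
  /-- `Δ(a_λ b) = (I ⊗ L(a)_λ) Δ(b) + (R(b)_{-λ-∂^{⊗2}} ⊗ I) Δ(a)` -/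
  compat₁ : ∀ a b, coeffwise Δ (m a b) =
    tensorLeft (L m a) (Δ b) + reflect (derTensor D) (tensorRight (Rt D m b) (Δ a))
  /-- `(L(b)_{-λ-∂^{⊗2}} ⊗ I - I ⊗ R(b)_{-λ-∂^{⊗2}}) Δ(a)
    + τ (L(a)_λ ⊗ I - I ⊗ R(a)_λ) Δ(b) = 0` -/
  compat₂ : ∀ a b,
    reflect (derTensor D) (tensorRight (L m b) (Δ a) - tensorLeft (Rt D m b) (Δ a)) +
      coeffwise (flip R M) (tensorRight (L m a) (Δ b) - tensorLeft (Rt D m a) (Δ b)) = 0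

/-- Commutative and cocommutative ASI conformal bialgebras. -/
structure IsCommCocommASIBialgebra (D : Module.End R M) (m : LambdaProduct R M)
    (Δ : M →ₗ[R] M ⊗[R] M) : Prop where
  asi : IsASIBialgebra D m Δ
  comm : IsCommutative D m
  cocomm : IsCocommutative Δ

/-- Lie conformal bialgebras. -/
structure IsLieBialgebra (D : Module.End R M) (br : LambdaProduct R M)
    (δ : M →ₗ[R] M ⊗[R] M) : Prop where
  lie : IsLieAlgebra D br
  colie : IsLieCoalgebra D δ
  /-- `δ([a_λ b]) = (ad(a)_λ ⊗ I + I ⊗ ad(a)_λ) δ(b)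
    - (ad(b)_{-λ-∂^{⊗2}} ⊗ I + I ⊗ ad(b)_{-λ-∂^{⊗2}}) δ(a)` -/
  cocycle : ∀ a b, coeffwise δ (br a b) =
    (tensorRight (L br a) (δ b) + tensorLeft (L br a) (δ b)) -
      reflect (derTensor D) (tensorRight (L br b) (δ a) + tensorLeft (L br b) (δ a))

/-- Poisson conformal bialgebras `(M, [·_λ·], ·_λ·, δ, Δ)`. -/
structure IsPoissonBialgebra (D : Module.End R M) (br m : LambdaProduct R M)
    (δ Δ : M →ₗ[R] M ⊗[R] M) : Prop where
  poisson : IsPoissonAlgebra D br m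
  copoisson : IsPoissonCoalgebra D δ Δ
  lie : IsLieBialgebra D br δ
  asi : IsCommCocommASIBialgebra D m Δ
  /-- `δ(a_λ b) = (L(a)_λ ⊗ I) δ(b) + (L(b)_{-λ-∂^{⊗2}} ⊗ I) δ(a)
    + (I ⊗ ad(a)_λ) Δ(b) + (I ⊗ ad(b)_{-λ-∂^{⊗2}}) Δ(a)` -/
  compat₁ : ∀ a b, coeffwise δ (m a b) =
    tensorRight (L m a) (δ b) + reflect (derTensor D) (tensorRight (L m b) (δ a)) +
      tensorLeft (L br a) (Δ b) + reflect (derTensor D) (tensorLeft (L br b) (Δ a))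
  /-- `Δ([a_λ b]) = (ad(a)_λ ⊗ I + I ⊗ ad(a)_λ) Δ(b)
    - (I ⊗ L(b)_{-λ-∂^{⊗2}}) δ(a) + (L(b)_{-λ-∂^{⊗2}} ⊗ I) δ(a)` -/
  compat₂ : ∀ a b, coeffwise Δ (br a b) =
    (tensorRight (L br a) (Δ b) + tensorLeft (L br a) (Δ b)) -
      reflect (derTensor D) (tensorLeft (L m b) (δ a)) +
      reflect (derTensor D) (tensorRight (L m b) (δ a))

end Algebras

/-! ## Topologically free `k[[h]]`-modules -/

section FormalSeries

/-- `V[[h]]`: the sequence `v` stands for `∑ v i h ^ i`. -/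
def FormalSeries (V : Type*) : Type _ := ℕ → V

namespace FormalSeries

variable {k : Type*} [Field k] {V : Type*} [AddCommGroup V] [Module k V]

instance : AddCommGroup (FormalSeries V) := inferInstanceAs (AddCommGroup (ℕ → V))

instance : Module k (FormalSeries V) := inferInstanceAs (Module k (ℕ → V))

/-- The coefficient of `hⁱ`. -/
def coeff {V : Type*} (i : ℕ) (v : FormalSeries V) : V := v i

/-- The series with given coefficients. -/
def mk {V : Type*} (v : ℕ → V) : FormalSeries V := v

theorem ext {V : Type*} {v w : FormalSeries V} (h : ∀ i, coeff i v = coeff i w) : v = w := funext h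

theorem coeff_mk {V : Type*} (v : ℕ → V) (i : ℕ) : coeff i (mk v) = v i := rfl

theorem coeff_zero (i : ℕ) : coeff i (0 : FormalSeries V) = 0 := rfl

theorem coeff_add (v w : FormalSeries V) (i : ℕ) : coeff i (v + w) = coeff i v + coeff i w := rfl

theorem coeff_csmul (c : k) (v : FormalSeries V) (i : ℕ) : coeff i (c • v) = c • coeff i v := rfl

/-- `(∑ kᵢ hⁱ) (∑ vᵢ hⁱ) = ∑ᵢ (∑_{p+q=i} k_p v_q) hⁱ`. -/
instance : SMul k⟦X⟧ (FormalSeries V) where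
  smul f v := mk fun i =>
    ∑ p ∈ Finset.HasAntidiagonal.antidiagonal i, PowerSeries.coeff p.1 f • coeff p.2 v

theorem coeff_smul (f : k⟦X⟧) (v : FormalSeries V) (i : ℕ) : coeff i (f • v) =
    ∑ p ∈ Finset.HasAntidiagonal.antidiagonal i, PowerSeries.coeff p.1 f • coeff p.2 v := rfl

theorem C_smul (c : k) (v : FormalSeries V) : PowerSeries.C c • v = c • v := by
  refine ext fun i => ?_
  rw [coeff_smul, coeff_csmul, Finset.sum_eq_single (0, i)]
  · simp only [PowerSeries.coeff_zero_C]
  · rintro ⟨p, q⟩ hp hne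
    have hp0 : p ≠ 0 := by
      rintro rfl
      simp only [Finset.HasAntidiagonal.mem_antidiagonal, zero_add] at hp
      exact hne (by rw [hp])
    simp [PowerSeries.coeff_C, hp0]
  · simp

instance : Module k⟦X⟧ (FormalSeries V) where
  one_smul v := by
    rw [← map_one (PowerSeries.C (R := k)), C_smul, one_smul]
  mul_smul f g v := by
    refine ext fun i => ?_
    simp only [coeff_smul, PowerSeries.coeff_mul, Finset.sum_smul, Finset.smul_sum, mul_smul]
    simp only [Finset.sum_sigma']
    refine Finset.sum_nbij' (fun x => ⟨(x.2.1, x.2.2 + x.1.2), (x.2.2, x.1.2)⟩)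
      (fun x => ⟨(x.1.1 + x.2.1, x.2.2), (x.1.1, x.2.1)⟩) ?_ ?_ ?_ ?_ ?_
    all_goals
      rintro ⟨⟨p, q⟩, ⟨r, s⟩⟩ h
      simp only [Finset.mem_sigma, Finset.HasAntidiagonal.mem_antidiagonal] at h
      obtain ⟨h1, h2⟩ := h
      subst h1 h2
      simp [Finset.HasAntidiagonal.mem_antidiagonal, add_assoc]
  smul_zero f := ext fun i => by
    rw [coeff_smul]
    exact Finset.sum_eq_zero fun p _ => smul_zero _
  smul_add f v w := ext fun i => by
    simp only [coeff_smul, coeff_add, smul_add, Finset.sum_add_distrib]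
  add_smul f g v := ext fun i => by
    simp only [coeff_smul, coeff_add, map_add, add_smul, Finset.sum_add_distrib]
  zero_smul v := ext fun i => by
    rw [coeff_smul, coeff_zero]
    exact Finset.sum_eq_zero fun p _ => by rw [map_zero, zero_smul]

instance : SMulCommClass k⟦X⟧ k (FormalSeries V) where
  smul_comm f c v := by
    rw [← C_smul, ← C_smul, ← mul_smul, ← mul_smul, mul_comm]

variable (k) in
/-- The inclusion of the constant series, `V → V[[h]]`. -/
def incl (V : Type*) [AddCommGroup V] [Module k V] : V →ₗ[k] FormalSeries V :=
  LinearMap.single k (fun _ : ℕ => V) 0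

/-- The coefficientwise extension `∑ vᵢ hⁱ ↦ ∑ D(vᵢ) hⁱ` of an endomorphism of `V`. -/
def lift (D : Module.End k V) : Module.End k⟦X⟧ (FormalSeries V) where
  toFun v := mk fun i => D (coeff i v)
  map_add' v w := ext fun i => map_add D (coeff i v) (coeff i w)
  map_smul' f v := ext fun i => by
    simp only [coeff_mk, coeff_smul, map_sum, map_smul, RingHom.id_apply]

variable (k) in
/-- The natural map `V ⊗_k V → V[[h]] ⊗_{k[[h]]} V[[h]]`. -/
def tensorIncl (V : Type*) [AddCommGroup V] [Module k V] :
    V ⊗[k] V →ₗ[k] FormalSeries V ⊗[k⟦X⟧] FormalSeries V :=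
  TensorProduct.lift <| LinearMap.mk₂ k (fun v w => incl k V v ⊗ₜ[k⟦X⟧] incl k V w)
    (fun _ _ _ => by rw [map_add, TensorProduct.add_tmul])
    (fun _ _ _ => by rw [map_smul, TensorProduct.smul_tmul'])
    (fun _ _ _ => by rw [map_add, TensorProduct.tmul_add])
    (fun c v w => by
      rw [map_smul, ← C_smul c (incl k V w), TensorProduct.tmul_smul, TensorProduct.smul_tmul',
        C_smul, TensorProduct.smul_tmul'])

end FormalSeries

/-- The ideal `(h)` of `k[[h]]`. -/
abbrev hIdeal (k : Type*) [Field k] : Ideal k⟦X⟧ := Ideal.span {PowerSeries.X}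

theorem hIdeal_fg (k : Type*) [Field k] : (hIdeal k).FG := ⟨{PowerSeries.X}, by simp⟩

variable {k : Type*} [Field k]

section Completion

variable {A B : Type*} [AddCommGroup A] [Module k⟦X⟧ A] [AddCommGroup B] [Module k⟦X⟧ B]

variable (k) in
/-- The `h`-adic completion of a `k[[h]]`-module. -/
abbrev Completion (A : Type*) [AddCommGroup A] [Module k⟦X⟧ A] : Type _ :=
  AdicCompletion (hIdeal k) A

variable (k) in
/-- The completed tensor product `A ⊗̂ B` over `k[[h]]`. -/
abbrev CTensor (A B : Type*) [AddCommGroup A] [Module k⟦X⟧ A] [AddCommGroup B]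
    [Module k⟦X⟧ B] : Type _ := Completion k (A ⊗[k⟦X⟧] B)

/-- The completion of a linear map. -/
def cmap (f : A →ₗ[k⟦X⟧] B) : Completion k A →ₗ[k⟦X⟧] Completion k B :=
  (AdicCompletion.map (hIdeal k) f).restrictScalars k⟦X⟧

/-- The continuous extension of a linear map with complete target to the completion. -/
def cextend (f : A →ₗ[k⟦X⟧] Completion k B) : Completion k A →ₗ[k⟦X⟧] Completion k B :=
  haveI : IsAdicComplete (hIdeal k) (Completion k B) := AdicCompletion.isAdicComplete (hIdeal_fg k)
  (AdicCompletion.ofLinearEquiv (hIdeal k) (Completion k B)).symm.toLinearMap ∘ₗ cmap f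

theorem cmap_add (f g : A →ₗ[k⟦X⟧] B) : cmap (f + g) = cmap f + cmap g := by
  refine LinearMap.ext fun x => ?_
  induction x using AdicCompletion.induction_on
  simp only [cmap, LinearMap.coe_restrictScalars, LinearMap.add_apply,
    AdicCompletion.map_mk]
  rfl

theorem cmap_smul (r : k⟦X⟧) (f : A →ₗ[k⟦X⟧] B) : cmap (r • f) = r • cmap f := by
  refine LinearMap.ext fun x => ?_
  induction x using AdicCompletion.induction_on
  simp only [cmap, LinearMap.coe_restrictScalars, LinearMap.smul_apply,
    AdicCompletion.map_mk]
  rfl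

/-- The natural map `A ⊗ B^ → (A ⊗ B)^`. -/
def tensorComplete : A ⊗[k⟦X⟧] Completion k B →ₗ[k⟦X⟧] CTensor k A B :=
  TensorProduct.lift
    { toFun := fun x => cmap (TensorProduct.mk k⟦X⟧ A B x)
      map_add' := fun x y => by rw [map_add, cmap_add]
      map_smul' := fun r x => by rw [map_smul, cmap_smul, RingHom.id_apply] }

variable {M : Type*} [AddCommGroup M] [Module k⟦X⟧ M]

/-- `I ⊗̂ f : M ⊗̂ M → M ⊗̂ M ⊗̂ M` for `f : M → M ⊗̂ M`. -/
def ctensorLeft (f : M →ₗ[k⟦X⟧] CTensor k M M) :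
    CTensor k M M →ₗ[k⟦X⟧] CTensor k M (M ⊗[k⟦X⟧] M) :=
  cextend (tensorComplete ∘ₗ f.lTensor M)

/-- `f ⊗̂ I : M ⊗̂ M → M ⊗̂ M ⊗̂ M` for `f : M → M ⊗̂ M`. -/
def ctensorRight (f : M →ₗ[k⟦X⟧] CTensor k M M) :
    CTensor k M M →ₗ[k⟦X⟧] CTensor k M (M ⊗[k⟦X⟧] M) :=
  cextend (cmap ((TensorProduct.assoc k⟦X⟧ M M M).toLinearMap ∘ₗ
      (TensorProduct.comm k⟦X⟧ M (M ⊗[k⟦X⟧] M)).toLinearMap) ∘ₗ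
    tensorComplete ∘ₗ (TensorProduct.comm k⟦X⟧ (CTensor k M M) M).toLinearMap ∘ₗ f.rTensor M)

variable (k) in
/-- The quotient `M / hⁿM`. -/
abbrev Quot (M : Type*) [AddCommGroup M] [Module k⟦X⟧ M] (n : ℕ) : Type _ :=
  M ⧸ ((hIdeal k) ^ n • ⊤ : Submodule k⟦X⟧ M)

variable (k) in
/-- The class of an element in `M / hⁿM`. -/
abbrev quotMk (M : Type*) [AddCommGroup M] [Module k⟦X⟧ M] (n : ℕ) : M →ₗ[k⟦X⟧] Quot k M n :=
  Submodule.mkQ _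

/-- The endomorphism of `M / hⁿM` induced by an endomorphism of `M`. -/
def quotEnd (D : Module.End k⟦X⟧ M) (n : ℕ) : Module.End k⟦X⟧ (Quot k M n) :=
  Submodule.mapQ _ _ D (Submodule.smul_top_le_comap_smul_top _ D)

/-- The natural map `(M ⊗ M) / hⁿ(M ⊗ M) → M/hⁿM ⊗ M/hⁿM`
(an isomorphism). -/
def quotTensor (M : Type*) [AddCommGroup M] [Module k⟦X⟧ M] (n : ℕ) :
    Quot k (M ⊗[k⟦X⟧] M) n →ₗ[k⟦X⟧] Quot k M n ⊗[k⟦X⟧] Quot k M n :=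
  Submodule.liftQ _ (TensorProduct.map (quotMk k M n) (quotMk k M n)) <| by
    refine (Submodule.smul_top_le_comap_smul_top _
      (TensorProduct.map (quotMk k M n) (quotMk k M n))).trans fun x hx => ?_
    have h0 : ((hIdeal k) ^ n • ⊤ : Submodule k⟦X⟧ (Quot k M n ⊗[k⟦X⟧] Quot k M n)) = ⊥ := by
      rw [eq_bot_iff, Submodule.smul_le]
      intro r hr y hy'
      clear hy'
      rw [Submodule.mem_bot]
      induction y using TensorProduct.induction_on with
      | zero => exact smul_zero r
      | add y z hy hz => rw [smul_add, hy, hz, add_zero]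
      | tmul y z =>
        obtain ⟨y, rfl⟩ := Submodule.mkQ_surjective _ y
        have hy : quotMk k M n (r • y) = 0 :=
          (Submodule.Quotient.mk_eq_zero _).2 (Submodule.smul_mem_smul hr trivial)
        rw [TensorProduct.smul_tmul', ← map_smul, hy, TensorProduct.zero_tmul]
    simpa [h0] using hx

end Completion

/-! ## `h`-adic structures

Continuity for the `h`-adic topologies is automatic for `k[[h]]`-linear and `k[[h]]`-bilinear
maps, as these carry multiples of `hⁿ` to multiples of `hⁿ`. -/

section HAdic

variable {M : Type*} [AddCommGroup M] [Module k⟦X⟧ M]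

variable (k) in
/-- `k[[h]]`-bilinear maps `M × M → M[[λ]]`; a series in `λ` is its sequence of coefficients. -/
abbrev FormalLambdaProduct (M : Type*) [AddCommGroup M] [Module k⟦X⟧ M] : Type _ :=
  M →ₗ[k⟦X⟧] M →ₗ[k⟦X⟧] (ℕ → M)

/-- `mn` is the `λ`-product on `M / hⁿM` induced by `m`; it takes values in polynomials in `λ`. -/
def IsReduction (m : FormalLambdaProduct k M) (n : ℕ)
    (mn : LambdaProduct k⟦X⟧ (Quot k M n)) : Prop :=
  ∀ a b j, mn (quotMk k M n a) (quotMk k M n b) j = quotMk k M n (m a b j)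

/-- `Δn` is the coproduct on `M / hⁿM` induced by `Δ`. -/
def IsCoReduction (Δ : M →ₗ[k⟦X⟧] CTensor k M M) (n : ℕ)
    (Δn : Quot k M n →ₗ[k⟦X⟧] Quot k M n ⊗[k⟦X⟧] Quot k M n) : Prop :=
  ∀ a, Δn (quotMk k M n a) = quotTensor M n (AdicCompletion.eval (hIdeal k) _ n (Δ a))

/-- `h`-adic associative conformal algebras. -/
def IsHAdicAssocAlgebra (D : Module.End k⟦X⟧ M) (m : FormalLambdaProduct k M) : Prop :=
  ∀ n, ∃ mn : LambdaProduct k⟦X⟧ (Quot k M n),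
    IsReduction m n mn ∧ IsAssocAlgebra (quotEnd D n) mn

/-- `h`-adic associative conformal coalgebras. -/
structure IsHAdicAssocCoalgebra (D : Module.End k⟦X⟧ M) (Δ : M →ₗ[k⟦X⟧] CTensor k M M) :
    Prop where
  hom : ∀ a, Δ (D a) = cmap (derTensor D) (Δ a)
  coassoc : ∀ a, ctensorLeft Δ (Δ a) = ctensorRight Δ (Δ a)

/-- `h`-adic ASI conformal bialgebras. -/
structure IsHAdicASIBialgebra (D : Module.End k⟦X⟧ M) (m : FormalLambdaProduct k M)
    (Δ : M →ₗ[k⟦X⟧] CTensor k M M) : Prop where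
  assoc : IsHAdicAssocAlgebra D m
  coassoc : IsHAdicAssocCoalgebra D Δ
  asi : ∀ n, ∃ (mn : LambdaProduct k⟦X⟧ (Quot k M n))
    (Δn : Quot k M n →ₗ[k⟦X⟧] Quot k M n ⊗[k⟦X⟧] Quot k M n),
    IsReduction m n mn ∧ IsCoReduction Δ n Δn ∧ IsASIBialgebra (quotEnd D n) mn Δn

end HAdic

/-! ## Conformal formal deformations and their semi-classical limits -/

section Deformations

variable {P : Type*} [AddCommGroup P] [Module k P]

/-- Conformal formal deformations `(P[[h]], ∘^h_λ, Δ_h)` of `(P, ·_λ·, Δ)`, together with the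
(uniquely determined) coefficients `{·_λ·}_{μ_i}` and `Δ_i` of their expansions in `h`. The
`k[∂]`-module structure of `P[[h]]` is the natural one. -/
structure FormalDeformation (D : Module.End k P) (m : LambdaProduct k P)
    (Δ : P →ₗ[k] P ⊗[k] P) where
  /-- the `λ`-product `∘^h_λ` -/
  prod : FormalLambdaProduct k (FormalSeries P)
  /-- the coproduct `Δ_h` -/
  coprod : FormalSeries P →ₗ[k⟦X⟧] CTensor k (FormalSeries P) (FormalSeries P)
  /-- `prodCoeff i` is `{·_λ·}_{μ_i}` for `i ≥ 1` -/
  prodCoeff : ℕ → LambdaProduct k P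
  /-- `coprodCoeff i` is `Δ_i` for `i ≥ 1` -/
  coprodCoeff : ℕ → P →ₗ[k] P ⊗[k] P
  asi : IsHAdicASIBialgebra (FormalSeries.lift D) prod coprod
  prodCoeff_zero : prodCoeff 0 = m
  coprodCoeff_zero : coprodCoeff 0 = Δ
  coprodCoeff_hom : ∀ i, 1 ≤ i → IsDerHom D (coprodCoeff i)
  /-- `a ∘^h_λ b = a_λ b + ∑_{i ≥ 1} hⁱ {a_λ b}_{μ_i}` for `a, b ∈ P`, compared at `λʲ` -/
  prod_eq : ∀ (a b : P) (j i : ℕ),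
    FormalSeries.coeff i (prod (FormalSeries.incl k P a) (FormalSeries.incl k P b) j) =
      prodCoeff i a b j
  /-- `Δ_h(a) = Δ(a) + ∑_{i ≥ 1} Δ_i(a) hⁱ` for `a ∈ P`, compared modulo every `hⁿ` -/
  coprod_eq : ∀ (a : P) (n : ℕ),
    AdicCompletion.eval (hIdeal k) _ n (coprod (FormalSeries.incl k P a)) =
      quotMk k _ n (∑ i ∈ Finset.range n,
        (PowerSeries.X : k⟦X⟧) ^ i • FormalSeries.tensorIncl k P (coprodCoeff i a))

namespace FormalDeformation

variable {D : Module.End k P} {m : LambdaProduct k P} {Δ : P →ₗ[k] P ⊗[k] P}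

/-- `[a_λ b] = {a_λ b}_{μ_1} - {b_{-λ-∂} a}_{μ_1}`, the class modulo `h` of
`(a ∘^h_λ b - b ∘^h_{-λ-∂} a) / h`. -/
def bracket (F : FormalDeformation D m Δ) : LambdaProduct k P :=
  F.prodCoeff 1 - opposite D (F.prodCoeff 1)

/-- `δ = Δ_1 - τ Δ_1`, the class modulo `h` of `(Δ_h - τ Δ_h) / h`. -/
def cobracket (F : FormalDeformation D m Δ) : P →ₗ[k] P ⊗[k] P :=
  F.coprodCoeff 1 - flip k P ∘ₗ F.coprodCoeff 1

end FormalDeformation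

end Deformations

end FormalSeries

end

end Conformal

/-! Write the deformed operations on constants as `∑ hⁱ mᵢ` and `∑ hⁱ Δᵢ`, with `m₀` and `Δ₀` the
given product and coproduct. The classical argument says that the commutator and the cocommutator
are divisible by `h`, and that the Poisson axioms survive division by the right power of `h` and
reduction modulo `h`. Here the division is replaced by a comparison of coefficients.

Every associative, coassociative or ASI axiom involves two operations, so its coefficient at `hⁿ` is
a sum over pairs `(i, j)` with `i + j = n`. These summed identities are `IsAssocSum`, `IsCoassocSum`
and `IsASISum`, and `expansion_identities` provides them for every `n`. A Lie or Poisson identity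
for commutators is a signed sum of associators, coassociators or ASI defects with permuted
arguments. Such an argument never needs the two operations of a pair to be equal, so it applies to
the sums as well: `IsAssocSum.jacobi`, `IsAssocSum.leibniz`, `IsCoassocSum.jacobi`,
`IsCoassocSum.leibniz`, `IsASISum.cocycle`, `IsASISum.leibniz`, `IsASISum.coLeibniz`.

The commutator of `m₀` and the cocommutator of `Δ₀` vanish. At `n = 2`, in identities where both
operations of a pair are commutators or cocommutators, only the pair `(1, 1)` survives: this gives
Jacobi, co-Jacobi and the Lie cocycle condition. At `n = 1` the identities with a single commutator
or cocommutator per term pair the bracket or cobracket with `m` or `Δ`: this gives both Leibniz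
rules and the two mixed compatibilities.

The conformal feature is that an opposite product replaces `λ` by `-λ - ∂`. Nested products are
therefore evaluated at arbitrary commuting operators, which turns the bookkeeping of `λ`, `μ`, `∂`
into arithmetic of operators. -/

namespace Conformal

/-! ### Substitution of operators for `λ` -/

section Substitution

variable {R : Type*} [CommRing R] {V W U : Type*} [AddCommGroup V] [Module R V]
  [AddCommGroup W] [Module R W] [AddCommGroup U] [Module R U]

@[simp]
theorem subst_single (f : V →ₗ[R] W) (T : Module.End R W) (n : ℕ) (v : V) :
    subst f T (Finsupp.single n v) = (T ^ n) (f v) := by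
  simp [subst]

@[simp]
theorem lam_single (n : ℕ) (v : V) :
    lam R V (Finsupp.single n v) = Finsupp.single (n + 1) v := by
  simp [lam]

@[simp]
theorem coeffwise_single (f : V →ₗ[R] W) (n : ℕ) (v : V) :
    coeffwise f (Finsupp.single n v) = Finsupp.single n (f v) := by
  simp [coeffwise]

@[simp]
theorem coeffwise_apply (f : V →ₗ[R] W) (p : Poly V) (n : ℕ) : coeffwise f p n = f (p n) := by
  simp [coeffwise]

@[simp]
theorem subst_const (f : V →ₗ[R] W) (T : Module.End R W) (v : V) :
    subst f T (const R V v) = f v := by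
  simp [const]

theorem subst_lam (f : V →ₗ[R] W) (T : Module.End R W) (p : Poly V) :
    subst f T (lam R V p) = T (subst f T p) := by
  induction p using Finsupp.induction_linear with
  | zero => simp
  | add p q hp hq => simp only [map_add, hp, hq]
  | single n v => simp [pow_succ']

theorem subst_coeffwise (f : V →ₗ[R] W) (g : U →ₗ[R] V) (T : Module.End R W) (p : Poly U) :
    subst f T (coeffwise g p) = subst (f ∘ₗ g) T p := by
  induction p using Finsupp.induction_linear with
  | zero => simp
  | add p q hp hq => simp only [map_add, hp, hq]
  | single n v => simp

/-- A map intertwining `X` with `Y` intertwines their powers, so it passes through the substitution.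
All other compatibilities of `subst` are instances of this. -/
theorem map_subst (g : W →ₗ[R] U) (f : V →ₗ[R] W) (X : Module.End R W) (Y : Module.End R U)
    (h : ∀ w, g (X w) = Y (g w)) (p : Poly V) : g (subst f X p) = subst (g ∘ₗ f) Y p := by
  induction p using Finsupp.induction_linear with
  | zero => simp
  | add p q hp hq => simp only [map_add, hp, hq]
  | single n v =>
    have key : ∀ w, g ((X ^ n) w) = (Y ^ n) (g w) := by
      induction n with
      | zero => simp
      | succ n ih => intro w; simp [pow_succ', h, ih]
    simp [key]

theorem subst_congr {f g : V →ₗ[R] W} (T : Module.End R W) (h : ∀ v, f v = g v) (p : Poly V) :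
    subst f T p = subst g T p := by
  rw [LinearMap.ext h]

theorem subst_coeffwise_end (f : V →ₗ[R] W) (D : Module.End R V) (T E : Module.End R W)
    (hf : ∀ v, f (D v) = E (f v)) (h : Commute E T) (p : Poly V) :
    subst f T (coeffwise D p) = E (subst f T p) := by
  rw [subst_coeffwise, map_subst E f T T fun w => LinearMap.congr_fun h w]
  exact subst_congr T hf p

/-- This is where `-λ - ∂` becomes an operator: once `f` transports `∂` to an operator `E` commuting
with the value `T` of `λ`, reflecting amounts to changing that value to `-T - E`. The choice of `E`
varies with the position of the coefficient in a nested product. -/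
theorem subst_reflect (f : V →ₗ[R] W) (D : Module.End R V) (T E : Module.End R W)
    (hf : ∀ v, f (D v) = E (f v)) (h : Commute E T) (p : Poly V) :
    subst f T (reflect D p) = subst f (-T - E) p := by
  rw [reflect, map_subst (subst f T) _ _ (-T - E)]
  · exact subst_congr _ (fun v => subst_const f T v) p
  · intro w
    simp [subst_lam, subst_coeffwise_end f D T E hf h]

theorem subst_add_left (f g : V →ₗ[R] W) (T : Module.End R W) (p : Poly V) :
    subst (f + g) T p = subst f T p + subst g T p := by
  induction p using Finsupp.induction_linear with
  | zero => simp
  | add p q hp hq => rw [map_add, map_add, map_add, hp, hq]; abel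
  | single n v => simp

theorem subst_sub_left (f g : V →ₗ[R] W) (T : Module.End R W) (p : Poly V) :
    subst (f - g) T p = subst f T p - subst g T p := by
  rw [eq_sub_iff_add_eq, ← subst_add_left, sub_add_cancel]

theorem commute_lam_coeffwise (D : Module.End R V) : Commute (lam R V) (coeffwise D) := by
  refine LinearMap.ext fun p => ?_
  induction p using Finsupp.induction_linear with
  | zero => simp
  | add p q hp hq => simp only [map_add, hp, hq]
  | single n v => simp

theorem subst_const_lam (p : Poly V) : subst (const R V) (lam R V) p = p := by
  induction p using Finsupp.induction_linear with
  | zero => simp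
  | add p q hp hq => simp only [map_add, hp, hq]
  | single n v =>
    rw [subst_single]
    induction n with
    | zero => simp [const]
    | succ n ih => rw [pow_succ', Module.End.mul_apply, ih, lam_single]

theorem const_map (D : Module.End R V) (v : V) : const R V (D v) = coeffwise D (const R V v) := by
  simp [const]

theorem reflect_lam (D : Module.End R V) (p : Poly V) :
    reflect D (lam R V p) = (-lam R V - coeffwise D) (reflect D p) :=
  subst_lam _ _ _

theorem reflect_coeffwise (D : Module.End R V) (p : Poly V) :
    reflect D (coeffwise D p) = coeffwise D (reflect D p) := by
  refine subst_coeffwise_end _ D _ _ (const_map D) ?_ p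
  exact ((commute_lam_coeffwise D).symm.neg_right).sub_right (Commute.refl _)

/-- Because `-(-λ - ∂) - ∂ = λ`. -/
theorem reflect_reflect (D : Module.End R V) (p : Poly V) : reflect D (reflect D p) = p := by
  change subst _ _ (reflect D p) = p
  rw [subst_reflect _ D _ (coeffwise D) (const_map D)]
  · simpa using subst_const_lam p
  · exact ((commute_lam_coeffwise D).symm.neg_right).sub_right (Commute.refl _)

theorem coeffwise_lam (f : V →ₗ[R] W) (p : Poly V) :
    coeffwise f (lam R V p) = lam R W (coeffwise f p) := by
  induction p using Finsupp.induction_linear with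
  | zero => simp
  | add p q hp hq => simp only [map_add, hp, hq]
  | single n v => simp

theorem coeffwise_reflect (f : V →ₗ[R] W) (D : Module.End R V) (E : Module.End R W)
    (hf : ∀ v, f (D v) = E (f v)) (p : Poly V) :
    coeffwise f (reflect D p) = reflect E (coeffwise f p) := by
  rw [reflect, map_subst (coeffwise f) _ _ (-lam R W - coeffwise E), reflect, subst_coeffwise]
  · exact subst_congr _ (fun v => by simp [const]) p
  · intro w
    have : coeffwise f (coeffwise D w) = coeffwise E (coeffwise f w) :=
      Finsupp.ext fun n => by simp [hf]
    simp [coeffwise_lam, this]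

end Substitution

/-! ### Nested `λ`-products and identities for commutators -/

section Nested

variable {R : Type*} [CommRing R] {M W : Type*} [AddCommGroup M] [Module R M]
  [AddCommGroup W] [Module R W]

@[simp]
theorem opposite_apply (D : Module.End R M) (m : LambdaProduct R M) (a b : M) :
    opposite D m a b = reflect D (m b a) := rfl

/-- The commutator `a_λ b - b_{-λ-∂} a` of a `λ`-product. -/
noncomputable def commutator (D : Module.End R M) (m : LambdaProduct R M) : LambdaProduct R M :=
  m - opposite D m

theorem commutator_eq_zero {D : Module.End R M} {m : LambdaProduct R M} (h : IsCommutative D m) :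
    commutator D m = 0 :=
  sub_eq_zero.2 (LinearMap.ext₂ h)

theorem commutator_skew (D : Module.End R M) (m : LambdaProduct R M) (a b : M) :
    commutator D m a b = -opposite D (commutator D m) a b := by
  simp [commutator, reflect_reflect]

theorem IsSesquilinear.opposite {D : Module.End R M} {m : LambdaProduct R M}
    (h : IsSesquilinear D m) : IsSesquilinear D (opposite D m) where
  left a b := by
    simp only [opposite_apply, h.right, LinearMap.add_apply, map_add, reflect_coeffwise,
      reflect_lam, LinearMap.sub_apply, LinearMap.neg_apply]
    abel
  right a b := by
    simp only [opposite_apply, h.left, LinearMap.add_apply, map_neg,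
      reflect_lam, LinearMap.sub_apply, LinearMap.neg_apply]
    abel

theorem IsSesquilinear.sub {D : Module.End R M} {m m' : LambdaProduct R M}
    (h : IsSesquilinear D m) (h' : IsSesquilinear D m') : IsSesquilinear D (m - m') where
  left a b := by simp only [LinearMap.sub_apply, h.left, h'.left, map_sub]; abel
  right a b := by simp only [LinearMap.sub_apply, h.right, h'.right, map_sub]

theorem IsSesquilinear.commutator {D : Module.End R M} {m : LambdaProduct R M}
    (h : IsSesquilinear D m) : IsSesquilinear D (commutator D m) :=
  h.sub h.opposite

/-- `(a_S b)_T c`, with values in a module `W` receiving a map `ι` from `M`; the outer product is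
`m`, the inner one `m'`. -/
noncomputable def nestLeft (ι : M →ₗ[R] W) (T S : Module.End R W) (m m' : LambdaProduct R M)
    (a b c : M) : W :=
  subst (subst ι T ∘ₗ m.flip c) S (m' a b)

/-- `a_T (b_S c)`, with values in a module `W` receiving a map `ι` from `M`; the outer product is
`m`, the inner one `m'`. -/
noncomputable def nestRight (ι : M →ₗ[R] W) (T S : Module.End R W) (m m' : LambdaProduct R M)
    (a b c : M) : W :=
  subst (subst ι T ∘ₗ m a) S (m' b c)

/-- The three kinds of nested product in `M[λ, μ]` are the universal cases of two general ones; the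
swapped nesting only exchanges `a` with `b` and `λ` with `μ`. -/
theorem leftNested_eq (m m' : LambdaProduct R M) (a b c : M) : leftNested m m' a b c =
    nestLeft (const₂ R M) (lam₂ R M + mu₂ R M) (lam₂ R M) m m' a b c := rfl

theorem rightNested_eq (m m' : LambdaProduct R M) (a b c : M) : rightNested m m' a b c =
    nestRight (const₂ R M) (lam₂ R M) (mu₂ R M) m m' a b c := rfl

theorem rightNestedSwap_eq (m m' : LambdaProduct R M) (a b c : M) : rightNestedSwap m m' a b c =
    nestRight (const₂ R M) (mu₂ R M) (lam₂ R M) m m' b a c := rfl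

section Bilinear

variable (ι : M →ₗ[R] W) (T S : Module.End R W) (m n m' n' : LambdaProduct R M) (a b c : M)

theorem nestLeft_sub_left :
    nestLeft ι T S (m - n) m' a b c = nestLeft ι T S m m' a b c - nestLeft ι T S n m' a b c := by
  rw [nestLeft, nestLeft, nestLeft, ← subst_sub_left]
  exact subst_congr _ (fun v => by simp) _

theorem nestLeft_sub_right :
    nestLeft ι T S m (m' - n') a b c = nestLeft ι T S m m' a b c - nestLeft ι T S m n' a b c := by
  simp [nestLeft]

theorem nestRight_sub_left :
    nestRight ι T S (m - n) m' a b c =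
      nestRight ι T S m m' a b c - nestRight ι T S n m' a b c := by
  rw [nestRight, nestRight, nestRight, ← subst_sub_left]
  exact subst_congr _ (fun v => by simp) _

theorem nestRight_sub_right :
    nestRight ι T S m (m' - n') a b c =
      nestRight ι T S m m' a b c - nestRight ι T S m n' a b c := by
  simp [nestRight]

theorem nestLeft_zero_left : nestLeft ι T S 0 m' a b c = 0 := by
  rw [← sub_self (0 : LambdaProduct R M), nestLeft_sub_left, sub_self]

theorem nestLeft_zero_right : nestLeft ι T S m 0 a b c = 0 := by
  rw [← sub_self (0 : LambdaProduct R M), nestLeft_sub_right, sub_self]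

theorem nestRight_zero_left : nestRight ι T S 0 m' a b c = 0 := by
  rw [← sub_self (0 : LambdaProduct R M), nestRight_sub_left, sub_self]

theorem nestRight_zero_right : nestRight ι T S m 0 a b c = 0 := by
  rw [← sub_self (0 : LambdaProduct R M), nestRight_sub_right, sub_self]

end Bilinear

section Opposite

variable {D : Module.End R M} {ι : M →ₗ[R] W} {T S E : Module.End R W}
  {m : LambdaProduct R M} (m' : LambdaProduct R M) (a b c : M)

/-- An outer opposite exchanges left and right nesting. The derivation acts on the final value,
hence as `E`, and the outer parameter becomes `-T - E`. -/
theorem nestLeft_opposite_left (hι : ∀ v, ι (D v) = E (ι v)) (hT : Commute E T) :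
    nestLeft ι T S (opposite D m) m' a b c = nestRight ι (-T - E) S m m' c a b :=
  subst_congr _ (fun v => by simp [subst_reflect ι D T E hι hT]) _

theorem nestRight_opposite_left (hι : ∀ v, ι (D v) = E (ι v)) (hT : Commute E T) :
    nestRight ι T S (opposite D m) m' a b c = nestLeft ι (-T - E) S m m' b c a :=
  subst_congr _ (fun v => by simp [subst_reflect ι D T E hι hT]) _

/-- The derivation coming from the inner opposite sits in the left argument of the outer product,
where sesquilinearity makes it act as `-T`; so `-S - ∂` becomes `-S + T`. -/
theorem nestLeft_opposite_right (hm : IsSesquilinear D m) (hTS : Commute T S) :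
    nestLeft ι T S m (opposite D m') a b c = nestLeft ι T (-S + T) m m' b a c := by
  rw [nestLeft, opposite_apply, subst_reflect _ D S (-T), sub_neg_eq_add]
  · rfl
  · intro v
    simp [hm.left, subst_lam]
  · exact hTS.neg_left

/-- Here the derivation sits in the right argument of the outer product, where sesquilinearity makes
it act as `E + T`. -/
theorem nestRight_opposite_right (hm : IsSesquilinear D m) (hι : ∀ v, ι (D v) = E (ι v))
    (hT : Commute E T) (hS : Commute E S) (hTS : Commute T S) :
    nestRight ι T S m (opposite D m') a b c = nestRight ι T (-S - (E + T)) m m' a c b := by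
  rw [nestRight, opposite_apply, subst_reflect _ D S (E + T)]
  · rfl
  · intro v
    simp [hm.right, subst_lam, subst_coeffwise_end ι D T E hι hT]
  · exact hS.add_left hTS

end Opposite

theorem map_nestLeft {U : Type*} [AddCommGroup U] [Module R U] (g : W →ₗ[R] U) (ι : M →ₗ[R] W)
    (T S : Module.End R W) (T' S' : Module.End R U) (hT : ∀ w, g (T w) = T' (g w))
    (hS : ∀ w, g (S w) = S' (g w)) (m m' : LambdaProduct R M) (a b c : M) :
    g (nestLeft ι T S m m' a b c) = nestLeft (g ∘ₗ ι) T' S' m m' a b c := by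
  rw [nestLeft, map_subst g _ S S' hS]
  exact subst_congr _ (fun v => map_subst g ι T T' hT _) _

theorem map_nestRight {U : Type*} [AddCommGroup U] [Module R U] (g : W →ₗ[R] U) (ι : M →ₗ[R] W)
    (T S : Module.End R W) (T' S' : Module.End R U) (hT : ∀ w, g (T w) = T' (g w))
    (hS : ∀ w, g (S w) = S' (g w)) (m m' : LambdaProduct R M) (a b c : M) :
    g (nestRight ι T S m m' a b c) = nestRight (g ∘ₗ ι) T' S' m m' a b c := by
  rw [nestRight, map_subst g _ S S' hS]
  exact subst_congr _ (fun v => map_subst g ι T T' hT _) _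

/-- Evaluation `λ := T`, `μ := S` of polynomials in two variables. -/
theorem exists_eval₂ (ι : M →ₗ[R] W) (T S : Module.End R W) (h : Commute T S) :
    ∃ g : Poly₂ M →ₗ[R] W, (∀ w, g (lam₂ R M w) = T (g w)) ∧ (∀ w, g (mu₂ R M w) = S (g w)) ∧
      g ∘ₗ const₂ R M = ι := by
  refine ⟨subst (subst ι T) S, fun w => ?_, fun w => subst_lam _ _ w, ?_⟩
  · exact subst_coeffwise_end _ _ S T (fun v => subst_lam ι T v) h w
  · ext v
    simp [const₂]

variable {I : Type*} {s : Finset I} {m m' : I → LambdaProduct R M}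

/-- The sum over `s` of the associators of the pairs `(m i, m' i)` vanishes. -/
def IsAssocSum (s : Finset I) (m m' : I → LambdaProduct R M) : Prop :=
  ∀ a b c, ∑ i ∈ s, leftNested (m i) (m' i) a b c = ∑ i ∈ s, rightNested (m i) (m' i) a b c

/-- `M[λ, μ]` is universal for pairs of commuting operators, so associativity can be specialised to
any such pair, in particular to pairs involving `-λ - μ - ∂`. -/
theorem IsAssocSum.nest (h : IsAssocSum s m m') (ι : M →ₗ[R] W) {T S : Module.End R W}
    (hTS : Commute T S) (a b c : M) :
    ∑ i ∈ s, nestLeft ι (T + S) T (m i) (m' i) a b c =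
      ∑ i ∈ s, nestRight ι T S (m i) (m' i) a b c := by
  obtain ⟨g, hT, hS, rfl⟩ := exists_eval₂ ι T S hTS
  have := congrArg g (h a b c)
  simp only [map_sum, leftNested_eq, rightNested_eq] at this
  have hTS' : ∀ w, g ((lam₂ R M + mu₂ R M) w) = (T + S) (g w) := fun w => by simp [hT, hS]
  simpa only [map_nestLeft g _ _ _ (T + S) T hTS' hT, map_nestRight g _ _ _ T S hT hS] using this

theorem commute_lam₂_mu₂ : Commute (lam₂ R M) (mu₂ R M) :=
  (commute_lam_coeffwise _).symm

theorem commute_der_lam₂ (D : Module.End R M) :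
    Commute (coeffwise (coeffwise D)) (lam₂ R M) := by
  refine LinearMap.ext fun p => Finsupp.ext fun n => ?_
  simpa [lam₂] using LinearMap.congr_fun (commute_lam_coeffwise D).symm (p n)

theorem commute_der_mu₂ (D : Module.End R M) :
    Commute (coeffwise (coeffwise D)) (mu₂ R M) :=
  (commute_lam_coeffwise _).symm

theorem const₂_der (D : Module.End R M) (v : M) :
    const₂ R M (D v) = coeffwise (coeffwise D) (const₂ R M v) := by
  simp [const₂, const_map]

/-- The Jacobi identity for commutators. -/
theorem IsAssocSum.jacobi {D : Module.End R M} (h : IsAssocSum s m m')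
    (hm : ∀ i ∈ s, IsSesquilinear D (m i)) (a b c : M) :
    ∑ i ∈ s, rightNested (commutator D (m i)) (commutator D (m' i)) a b c =
      ∑ i ∈ s, (leftNested (commutator D (m i)) (commutator D (m' i)) a b c +
        rightNestedSwap (commutator D (m i)) (commutator D (m' i)) a b c) := by
  simp only [leftNested_eq, rightNested_eq, rightNestedSwap_eq]
  have xy := commute_lam₂_mu₂ (R := R) (M := M)
  have dx := commute_der_lam₂ D
  have dy := commute_der_mu₂ D
  have hι := const₂_der D
  -- From here only the commutation relations and the rule for `ι` matter, so the concrete operators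
  -- are forgotten.
  generalize const₂ R M = ι at *
  generalize coeffwise (coeffwise D) = d at *
  generalize lam₂ R M = x at *
  generalize mu₂ R M = y at *
  have xz : Commute x (-x - y - d) := ((Commute.refl x).neg_right.sub_right xy).sub_right dx.symm
  have yz : Commute y (-x - y - d) := (xy.symm.neg_right.sub_right (Commute.refl y)).sub_right dy.symm
  -- The parameters attached to `a`, `b`, `c` are `x`, `y` and `-x - y - d`. Each of the six
  -- orderings of the arguments carries its parameters along.
  have h1 := h.nest ι xy a b c
  have h2 := h.nest ι xy.symm b a c
  have h3 := h.nest ι xz a c b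
  have h4 := h.nest ι yz b c a
  have h5 := h.nest ι yz.symm c b a
  have h6 := h.nest ι xz.symm c a b
  -- For a single pair, without associativity, the Jacobi defect is the alternating sum of the six
  -- permuted associators. The twelve products from expanding the commutators are the twelve nested
  -- products in these associators.
  have key : ∀ i ∈ s,
      nestRight ι x y (commutator D (m i)) (commutator D (m' i)) a b c -
      (nestLeft ι (x + y) x (commutator D (m i)) (commutator D (m' i)) a b c +
        nestRight ι y x (commutator D (m i)) (commutator D (m' i)) b a c) =
      nestRight ι x y (m i) (m' i) a b c - nestLeft ι (x + y) x (m i) (m' i) a b c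
      - (nestRight ι y x (m i) (m' i) b a c - nestLeft ι (y + x) y (m i) (m' i) b a c)
      - (nestRight ι x (-x - y - d) (m i) (m' i) a c b
        - nestLeft ι (x + (-x - y - d)) x (m i) (m' i) a c b)
      + (nestRight ι y (-x - y - d) (m i) (m' i) b c a
        - nestLeft ι (y + (-x - y - d)) y (m i) (m' i) b c a)
      - (nestRight ι (-x - y - d) y (m i) (m' i) c b a
        - nestLeft ι (-x - y - d + y) (-x - y - d) (m i) (m' i) c b a)
      + (nestRight ι (-x - y - d) x (m i) (m' i) c a b
        - nestLeft ι (-x - y - d + x) (-x - y - d) (m i) (m' i) c a b) := by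
    intro i hi
    have hmi := hm i hi
    have dxy := dx.add_right dy
    simp only [commutator, nestLeft_sub_left, nestLeft_sub_right, nestRight_sub_left,
      nestRight_sub_right]
    rw [nestRight_opposite_right (m' i) a b c hmi hι dx dy xy,
      nestRight_opposite_left (m' i) a b c hι dx,
      nestRight_opposite_left (opposite D (m' i)) a b c hι dx,
      nestLeft_opposite_right (m' i) b c a hmi (xy.neg_left.sub_left dy),
      nestRight_opposite_right (m' i) b a c hmi hι dy dx xy.symm,
      nestRight_opposite_left (m' i) b a c hι dy,
      nestRight_opposite_left (opposite D (m' i)) b a c hι dy,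
      nestLeft_opposite_right (m' i) a c b hmi (xy.symm.neg_left.sub_left dx),
      nestLeft_opposite_left (m' i) a b c hι dxy,
      nestLeft_opposite_left (opposite D (m' i)) a b c hι dxy,
      nestRight_opposite_right (m' i) c a b hmi hι (dxy.neg_right.sub_right (Commute.refl _)) dx
        ((((Commute.refl x).add_left xy.symm).neg_left).sub_left dx),
      nestLeft_opposite_right (m' i) a b c hmi ((Commute.refl x).add_left xy.symm)]
    -- Equal parameters must agree syntactically before `abel` can cancel the nested products.
    rw [show -y - (d + x) = -x - y - d by abel, show -x - (d + y) = -x - y - d by abel,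
      show -y + (-x - d) = -x - y - d by abel, show -x + (-y - d) = -x - y - d by abel,
      show -(x + y) - d = -x - y - d by abel, show -x - (d + (-x - y - d)) = y by abel,
      show -x + (x + y) = y by abel, show x + (-x - y - d) = -y - d by abel,
      show y + (-x - y - d) = -x - d by abel, show -x - y - d + x = -y - d by abel,
      show -x - y - d + y = -x - d by abel, show y + x = x + y by abel]
    abel
  rw [← sub_eq_zero, ← Finset.sum_sub_distrib, Finset.sum_congr rfl key]
  simp only [Finset.sum_sub_distrib, Finset.sum_add_distrib, h1, h2, h3, h4, h5, h6, sub_self,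
    add_zero]

/-- The Leibniz rule for commutators. -/
theorem IsAssocSum.leibniz {D : Module.End R M} (h : IsAssocSum s m m')
    (hm : ∀ i ∈ s, IsSesquilinear D (m i)) (a b c : M) :
    ∑ i ∈ s, rightNested (commutator D (m i)) (m' i) a b c =
      ∑ i ∈ s, (leftNested (m i) (commutator D (m' i)) a b c +
        rightNestedSwap (m i) (commutator D (m' i)) a b c) := by
  simp only [leftNested_eq, rightNested_eq, rightNestedSwap_eq]
  have xy := commute_lam₂_mu₂ (R := R) (M := M)
  have dx := commute_der_lam₂ D
  have dy := commute_der_mu₂ D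
  have hι := const₂_der D
  generalize const₂ R M = ι at *
  generalize coeffwise (coeffwise D) = d at *
  generalize lam₂ R M = x at *
  generalize mu₂ R M = y at *
  have yz : Commute y (-x - y - d) := (xy.symm.neg_right.sub_right (Commute.refl y)).sub_right dy.symm
  have h1 := h.nest ι xy a b c
  have h2 := h.nest ι xy.symm b a c
  have h4 := h.nest ι yz b c a
  -- The Leibniz defect has only one commutator in each term, and three of the six associators
  -- suffice.
  have key : ∀ i ∈ s,
      nestRight ι x y (commutator D (m i)) (m' i) a b c -
      (nestLeft ι (x + y) x (m i) (commutator D (m' i)) a b c +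
        nestRight ι y x (m i) (commutator D (m' i)) b a c) =
      nestRight ι x y (m i) (m' i) a b c - nestLeft ι (x + y) x (m i) (m' i) a b c
      - (nestRight ι y x (m i) (m' i) b a c - nestLeft ι (y + x) y (m i) (m' i) b a c)
      + (nestRight ι y (-x - y - d) (m i) (m' i) b c a
        - nestLeft ι (y + (-x - y - d)) y (m i) (m' i) b c a) := by
    intro i hi
    have hmi := hm i hi
    simp only [commutator, nestLeft_sub_right, nestRight_sub_left, nestRight_sub_right]
    rw [nestRight_opposite_left (m' i) a b c hι dx,
      nestRight_opposite_right (m' i) b a c hmi hι dy dx xy.symm,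
      nestLeft_opposite_right (m' i) a b c hmi ((Commute.refl x).add_left xy.symm)]
    rw [show -x - (d + y) = -x - y - d by abel,
      show -x + (x + y) = y by abel,
      show y + (-x - y - d) = -x - d by abel, show y + x = x + y by abel]
    abel
  rw [← sub_eq_zero, ← Finset.sum_sub_distrib, Finset.sum_congr rfl key]
  simp only [Finset.sum_sub_distrib, Finset.sum_add_distrib, h1, h2, h4, sub_self,
    add_zero]

end Nested

/-! ### Coproducts, permutations of tensor factors and cocommutators -/

section Coalgebra

variable {R : Type*} [CommRing R] {M : Type*} [AddCommGroup M] [Module R M]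

/-- The cocommutator `Δ - τ Δ` of a coproduct. -/
noncomputable def cocommutator (Δ : M →ₗ[R] M ⊗[R] M) : M →ₗ[R] M ⊗[R] M :=
  Δ - flip R M ∘ₗ Δ

@[simp]
theorem cocommutator_apply (Δ : M →ₗ[R] M ⊗[R] M) (a : M) :
    cocommutator Δ a = Δ a - flip R M (Δ a) := rfl

@[simp]
theorem flip_tmul (a b : M) : flip R M (a ⊗ₜ b) = b ⊗ₜ a := rfl

@[simp]
theorem flip_flip (x : M ⊗[R] M) : flip R M (flip R M x) = x := by
  simp [flip]

theorem cocommutator_eq_zero {Δ : M →ₗ[R] M ⊗[R] M} (h : IsCocommutative Δ) :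
    cocommutator Δ = 0 :=
  LinearMap.ext fun a => sub_eq_zero.2 (h a)

theorem cocommutator_skew (Δ : M →ₗ[R] M ⊗[R] M) (a : M) :
    cocommutator Δ a = -flip R M (cocommutator Δ a) := by
  simp

@[simp]
theorem derTensor_tmul (D : Module.End R M) (a b : M) :
    derTensor D (a ⊗ₜ b) = D a ⊗ₜ b + a ⊗ₜ D b := rfl

theorem flip_derTensor (D : Module.End R M) (x : M ⊗[R] M) :
    flip R M (derTensor D x) = derTensor D (flip R M x) := by
  induction x using TensorProduct.induction_on with
  | zero => simp
  | add x y hx hy => simp only [map_add, hx, hy]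
  | tmul a b => simp [add_comm]

theorem IsDerHom.cocommutator {D : Module.End R M} {Δ : M →ₗ[R] M ⊗[R] M} (h : IsDerHom D Δ) :
    IsDerHom D (cocommutator Δ) := fun a => by
  simp [h a, flip_derTensor]

section Bilinear

variable (f f' g g' : M →ₗ[R] M ⊗[R] M) (a : M)

theorem coLeft_sub_left : coLeft (f - f') g a = coLeft f g a - coLeft f' g a := by
  simp [coLeft, LinearMap.rTensor_sub]

theorem coLeft_sub_right : coLeft f (g - g') a = coLeft f g a - coLeft f g' a := by
  simp [coLeft]

theorem coRight_sub_left : coRight (f - f') g a = coRight f g a - coRight f' g a := by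
  simp [coRight, LinearMap.lTensor_sub]

theorem coRight_sub_right : coRight f (g - g') a = coRight f g a - coRight f g' a := by
  simp [coRight]

theorem coLeft_zero_left : coLeft 0 g a = 0 := by simp [coLeft]

theorem coLeft_zero_right : coLeft f 0 a = 0 := by simp [coLeft]

theorem coRight_zero_left : coRight 0 g a = 0 := by simp [coRight]

theorem coRight_zero_right : coRight f 0 a = 0 := by simp [coRight]

end Bilinear

variable (R M) in
/-- The transposition `I ⊗ τ` of `M ⊗ M ⊗ M`. -/
noncomputable def flipRight : Module.End R (M ⊗[R] (M ⊗[R] M)) := (flip R M).lTensor M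

/-- Linear endomorphisms of `M ⊗ M ⊗ M` that agree on pure tensors are equal. -/
theorem eq_of_eq_on_tmul₃ {f g : M ⊗[R] (M ⊗[R] M) →ₗ[R] M ⊗[R] (M ⊗[R] M)}
    (h : ∀ a b c, f (a ⊗ₜ (b ⊗ₜ c)) = g (a ⊗ₜ (b ⊗ₜ c))) (x) : f x = g x := by
  refine LinearMap.congr_fun (TensorProduct.ext ?_) x
  refine LinearMap.ext fun a => TensorProduct.ext' fun b c => h a b c

variable (f g : M →ₗ[R] M ⊗[R] M) (a : M)

theorem coRight_flip_left : coRight (flip R M ∘ₗ f) g a = flipRight R M (coRight f g a) := by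
  simp [coRight, flipRight, LinearMap.lTensor_comp]

theorem assoc_rTensor_tmul (x : M ⊗[R] M) (c : M) :
    flipLeft R M (TensorProduct.assoc R M M M (x ⊗ₜ c)) =
      TensorProduct.assoc R M M M (flip R M x ⊗ₜ c) := by
  induction x using TensorProduct.induction_on with
  | zero => simp
  | add x y hx hy => simp only [map_add, TensorProduct.add_tmul, hx, hy]
  | tmul a b => simp [flipLeft]

/-- Moving `c` from the last place to the first is a cyclic rotation, a product of two
transpositions. -/
theorem tmul_eq_rotate (x : M ⊗[R] M) (c : M) :
    c ⊗ₜ[R] x = flipLeft R M (flipRight R M (TensorProduct.assoc R M M M (x ⊗ₜ c))) := by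
  induction x using TensorProduct.induction_on with
  | zero => simp
  | add x y hx hy => simp only [map_add, TensorProduct.add_tmul, TensorProduct.tmul_add, hx, hy]
  | tmul a b => simp [flipLeft, flipRight]

theorem coLeft_flip_left : coLeft (flip R M ∘ₗ f) g a = flipLeft R M (coLeft f g a) := by
  simp only [coLeft, LinearMap.comp_apply, LinearEquiv.coe_coe]
  induction g a using TensorProduct.induction_on with
  | zero => simp
  | add x y hx hy => simp only [map_add, hx, hy]
  | tmul a b => simp [assoc_rTensor_tmul]

/-- Flipping the coproduct applied first changes which factor is split next, so `coRight` turns into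
`coLeft` up to a cyclic rotation. -/
theorem coRight_flip_right :
    coRight f (flip R M ∘ₗ g) a = flipLeft R M (flipRight R M (coLeft f g a)) := by
  simp only [coLeft, coRight, LinearMap.comp_apply, LinearEquiv.coe_coe]
  induction g a using TensorProduct.induction_on with
  | zero => simp
  | add x y hx hy => simp only [map_add, hx, hy]
  | tmul a b => simp [tmul_eq_rotate]

@[simp]
theorem flipLeft_flipLeft (x : M ⊗[R] (M ⊗[R] M)) : flipLeft R M (flipLeft R M x) = x :=
  eq_of_eq_on_tmul₃ (f := flipLeft R M ∘ₗ flipLeft R M) (g := LinearMap.id)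
    (fun a b c => by simp [flipLeft]) x

@[simp]
theorem flipRight_flipRight (x : M ⊗[R] (M ⊗[R] M)) : flipRight R M (flipRight R M x) = x :=
  eq_of_eq_on_tmul₃ (f := flipRight R M ∘ₗ flipRight R M) (g := LinearMap.id)
    (fun a b c => by simp [flipRight]) x

/-- The braid relation; it brings the permutations in the co-Jacobi identity to a common normal
form. -/
theorem flipRight_flipLeft_flipRight (x : M ⊗[R] (M ⊗[R] M)) :
    flipRight R M (flipLeft R M (flipRight R M x)) =
      flipLeft R M (flipRight R M (flipLeft R M x)) :=
  eq_of_eq_on_tmul₃ (f := flipRight R M ∘ₗ flipLeft R M ∘ₗ flipRight R M)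
    (g := flipLeft R M ∘ₗ flipRight R M ∘ₗ flipLeft R M)
    (fun a b c => by simp [flipRight, flipLeft]) x

theorem coLeft_flip_right :
    coLeft f (flip R M ∘ₗ g) a = flipRight R M (flipLeft R M (coRight f g a)) := by
  -- The previous rotation formula, applied to the flipped `g` and then inverted, since the two
  -- flips cancel.
  have := coRight_flip_right f (flip R M ∘ₗ g) a
  rw [← LinearMap.comp_assoc, show flip R M ∘ₗ flip R M = LinearMap.id from
    LinearMap.ext flip_flip, LinearMap.id_comp] at this
  rw [this]
  simp

variable {I : Type*} {s : Finset I} {Δ Δ' : I → M →ₗ[R] M ⊗[R] M}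

/-- The sum over `s` of the coassociators of the pairs `(Δ i, Δ' i)` vanishes. -/
def IsCoassocSum (s : Finset I) (Δ Δ' : I → M →ₗ[R] M ⊗[R] M) : Prop :=
  ∀ a, ∑ i ∈ s, coRight (Δ i) (Δ' i) a = ∑ i ∈ s, coLeft (Δ i) (Δ' i) a

/-- The co-Jacobi identity for cocommutators. -/
theorem IsCoassocSum.jacobi (h : IsCoassocSum s Δ Δ') (a : M) :
    ∑ i ∈ s, (coRight (cocommutator (Δ i)) (cocommutator (Δ' i)) a -
      flipLeft R M (coRight (cocommutator (Δ i)) (cocommutator (Δ' i)) a)) =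
    ∑ i ∈ s, coLeft (cocommutator (Δ i)) (cocommutator (Δ' i)) a := by
  -- All flips become permutations acting on `coRight` and `coLeft` of the original coproducts. Once
  -- they stand outside the sums, `h a` makes the two iterated coproducts equal and the terms
  -- cancel.
  simp only [cocommutator, coRight_sub_left, coRight_sub_right, coLeft_sub_left, coLeft_sub_right,
    coRight_flip_left, coRight_flip_right, coLeft_flip_left, coLeft_flip_right, map_sub,
    flipLeft_flipLeft, flipRight_flipLeft_flipRight, Finset.sum_sub_distrib,
    ← map_sum, h a]
  abel

/-- The co-Leibniz rule for cocommutators. -/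
theorem IsCoassocSum.leibniz (h : IsCoassocSum s Δ Δ') (a : M) :
    ∑ i ∈ s, coRight (Δ i) (cocommutator (Δ' i)) a =
    ∑ i ∈ s, (coLeft (cocommutator (Δ i)) (Δ' i) a +
      flipLeft R M (coRight (cocommutator (Δ i)) (Δ' i) a)) := by
  simp only [cocommutator, coRight_sub_left, coRight_sub_right, coLeft_sub_left,
    coRight_flip_left, coRight_flip_right, coLeft_flip_left, map_sub,
    Finset.sum_sub_distrib, Finset.sum_add_distrib, ← map_sum, h a]
  abel

end Coalgebra

/-! ### Compatibility of commutators and cocommutators -/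

section Bialgebra

variable {R : Type*} [CommRing R] {M : Type*} [AddCommGroup M] [Module R M]

theorem tensorRight_tmul_apply {U V W : Type*} [AddCommGroup U] [Module R U] [AddCommGroup V]
    [Module R V] [AddCommGroup W] [Module R W] (f : V →ₗ[R] Poly W) (v : V) (u : U) (n : ℕ) :
    tensorRight f (v ⊗ₜ[R] u) n = f v n ⊗ₜ u := by
  simp [tensorRight]

theorem tensorLeft_tmul_apply {U V W : Type*} [AddCommGroup U] [Module R U] [AddCommGroup V]
    [Module R V] [AddCommGroup W] [Module R W] (f : V →ₗ[R] Poly W) (v : V) (u : U) (n : ℕ) :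
    tensorLeft f (u ⊗ₜ[R] v) n = u ⊗ₜ f v n := by
  simp [tensorLeft]

theorem tensorRight_sub (f g : M →ₗ[R] Poly M) (x : M ⊗[R] M) :
    tensorRight (f - g) x = tensorRight f x - tensorRight g x := by
  simp [tensorRight, LinearMap.rTensor_sub]

theorem tensorLeft_sub (f g : M →ₗ[R] Poly M) (x : M ⊗[R] M) :
    tensorLeft (f - g) x = tensorLeft f x - tensorLeft g x := by
  simp [tensorLeft, LinearMap.lTensor_sub]

theorem flip_tensorRight (f : M →ₗ[R] Poly M) (x : M ⊗[R] M) :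
    coeffwise (flip R M) (tensorRight f x) = tensorLeft f (flip R M x) := by
  induction x using TensorProduct.induction_on with
  | zero => simp
  | add x y hx hy => simp only [map_add, hx, hy]
  | tmul a b =>
    ext n
    simp [tensorRight_tmul_apply, tensorLeft_tmul_apply]

theorem flip_tensorLeft (f : M →ₗ[R] Poly M) (x : M ⊗[R] M) :
    coeffwise (flip R M) (tensorLeft f x) = tensorRight f (flip R M x) := by
  rw [← flip_flip x, ← flip_tensorRight, flip_flip]
  ext n
  simp

theorem flip_reflect (D : Module.End R M) (p : Poly (M ⊗[R] M)) :
    coeffwise (flip R M) (reflect (derTensor D) p) =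
      reflect (derTensor D) (coeffwise (flip R M) p) :=
  coeffwise_reflect _ _ _ (flip_derTensor D) p

theorem coeffwise_cocommutator (Δ : M →ₗ[R] M ⊗[R] M) (p : Poly M) :
    coeffwise (cocommutator Δ) p = coeffwise Δ p - coeffwise (flip R M) (coeffwise Δ p) := by
  ext n
  simp

variable {I : Type*} {s : Finset I} {D : Module.End R M} {m : I → LambdaProduct R M}
  {Δ : I → M →ₗ[R] M ⊗[R] M}

/-- The sums over `s` of the defects, for the pairs `(m i, Δ i)`, of the two compatibility
conditions of an ASI bialgebra vanish. -/
structure IsASISum (D : Module.End R M) (s : Finset I) (m : I → LambdaProduct R M)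
    (Δ : I → M →ₗ[R] M ⊗[R] M) : Prop where
  compat₁ : ∀ a b, ∑ i ∈ s, coeffwise (Δ i) (m i a b) =
    ∑ i ∈ s, (tensorLeft (L (m i) a) (Δ i b) +
      reflect (derTensor D) (tensorRight (Rt D (m i) b) (Δ i a)))
  compat₂ : ∀ a b, ∑ i ∈ s,
    (reflect (derTensor D)
        (tensorRight (L (m i) b) (Δ i a) - tensorLeft (Rt D (m i) b) (Δ i a)) +
      coeffwise (flip R M)
        (tensorRight (L (m i) a) (Δ i b) - tensorLeft (Rt D (m i) a) (Δ i b))) = 0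

theorem commutator_apply (m : LambdaProduct R M) (a b : M) :
    commutator D m a b = m a b - opposite D m a b := rfl

theorem L_commutator (m : LambdaProduct R M) (a : M) :
    L (commutator D m) a = L m a - Rt D m a := rfl

namespace IsASISum

theorem compat₁_expanded (h : IsASISum D s m Δ) (a b : M) :
    ∑ i ∈ s, coeffwise (Δ i) (m i a b) = ∑ i ∈ s, tensorLeft (L (m i) a) (Δ i b) +
      ∑ i ∈ s, reflect (derTensor D) (tensorRight (Rt D (m i) b) (Δ i a)) := by
  rw [← Finset.sum_add_distrib, h.compat₁ a b]

theorem compat₂_expanded (h : IsASISum D s m Δ) (a b : M) :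
    ∑ i ∈ s, reflect (derTensor D) (tensorRight (L (m i) b) (Δ i a)) -
      ∑ i ∈ s, reflect (derTensor D) (tensorLeft (Rt D (m i) b) (Δ i a)) +
      (∑ i ∈ s, tensorLeft (L (m i) a) (flip R M (Δ i b)) -
        ∑ i ∈ s, tensorRight (Rt D (m i) a) (flip R M (Δ i b))) = 0 := by
  rw [← Finset.sum_sub_distrib, ← Finset.sum_sub_distrib, ← Finset.sum_add_distrib]
  simpa only [map_sub, flip_tensorRight, flip_tensorLeft] using h.compat₂ a b

/-- The image of the second ASI condition under `τ`, which exchanges the two tensor places and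
commutes with `λ ↦ -λ - ∂^{⊗2}`. -/
theorem compat₂_flip (h : IsASISum D s m Δ) (a b : M) :
    ∑ i ∈ s, reflect (derTensor D) (tensorLeft (L (m i) b) (flip R M (Δ i a))) -
      ∑ i ∈ s, reflect (derTensor D) (tensorRight (Rt D (m i) b) (flip R M (Δ i a))) +
      (∑ i ∈ s, tensorRight (L (m i) a) (Δ i b) -
        ∑ i ∈ s, tensorLeft (Rt D (m i) a) (Δ i b)) = 0 := by
  simpa only [map_sub, map_add, map_sum, flip_reflect, flip_tensorRight, flip_tensorLeft,
    flip_flip, map_zero] using congrArg (coeffwise (flip R M)) (h.compat₂_expanded a b)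

/-- Reflect the first ASI condition for `(b, a)`. A coproduct commuting with `∂` commutes with the
reflection, and the double reflection on the right cancels. -/
theorem compat₁_opposite (h : IsASISum D s m Δ) (hΔ : ∀ i ∈ s, IsDerHom D (Δ i)) (a b : M) :
    ∑ i ∈ s, coeffwise (Δ i) (opposite D (m i) a b) =
      ∑ i ∈ s, reflect (derTensor D) (tensorLeft (L (m i) b) (Δ i a)) +
      ∑ i ∈ s, tensorRight (Rt D (m i) a) (Δ i b) := by
  refine (Finset.sum_congr rfl fun i hi =>
    coeffwise_reflect (Δ i) D (derTensor D) (hΔ i hi) (m i b a)).trans ?_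
  simpa only [map_sum, map_add, reflect_reflect] using
    congrArg (reflect (derTensor D)) (h.compat₁_expanded b a)

/-- The first ASI condition, its reflection and their flips evaluate the left side. What remains is
the second ASI condition minus its flip. -/
theorem cocycle (h : IsASISum D s m Δ) (hΔ : ∀ i ∈ s, IsDerHom D (Δ i)) (a b : M) :
    ∑ i ∈ s, coeffwise (cocommutator (Δ i)) (commutator D (m i) a b) =
    ∑ i ∈ s, ((tensorRight (L (commutator D (m i)) a) (cocommutator (Δ i) b) +
        tensorLeft (L (commutator D (m i)) a) (cocommutator (Δ i) b)) -
      reflect (derTensor D) (tensorRight (L (commutator D (m i)) b) (cocommutator (Δ i) a) +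
        tensorLeft (L (commutator D (m i)) b) (cocommutator (Δ i) a))) := by
  rw [← sub_eq_zero]
  have e1 := h.compat₂_expanded a b
  have e2 := h.compat₂_flip a b
  simp only [coeffwise_cocommutator, commutator_apply, L_commutator, tensorRight_sub, tensorLeft_sub, cocommutator_apply,
    map_sub, map_add, Finset.sum_sub_distrib, Finset.sum_add_distrib, ← map_sum,
    h.compat₁_expanded, h.compat₁_opposite hΔ]
  simp only [map_sum, flip_reflect, flip_tensorRight, flip_tensorLeft]
  refine Eq.trans ?_ (sub_eq_zero.2 (e1.trans e2.symm))
  abel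

/-- The last summand, a commutator paired with a cocommutator, corrects for noncommutativity. It
vanishes at order `h`, where one index of each pair is `0`. -/
theorem leibniz (h : IsASISum D s m Δ) (a b : M) :
    ∑ i ∈ s, coeffwise (cocommutator (Δ i)) (m i a b) =
    ∑ i ∈ s, (tensorRight (L (m i) a) (cocommutator (Δ i) b) +
      reflect (derTensor D) (tensorRight (L (m i) b) (cocommutator (Δ i) a)) +
      tensorLeft (L (commutator D (m i)) a) (Δ i b) +
      reflect (derTensor D) (tensorLeft (L (commutator D (m i)) b) (Δ i a)) -
      reflect (derTensor D) (tensorRight (L (commutator D (m i)) b) (cocommutator (Δ i) a) +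
        tensorLeft (L (commutator D (m i)) b) (cocommutator (Δ i) a))) := by
  rw [← sub_eq_zero]
  have e2 := h.compat₂_flip a b
  simp only [coeffwise_cocommutator, L_commutator, tensorRight_sub, tensorLeft_sub,
    cocommutator_apply, map_sub, map_add, Finset.sum_sub_distrib, Finset.sum_add_distrib,
    ← map_sum, h.compat₁_expanded]
  simp only [map_sum, flip_reflect, flip_tensorRight, flip_tensorLeft]
  refine Eq.trans ?_ (neg_eq_zero.2 e2)
  abel

/-- Again the last summand is a correction that disappears at order `h`; the defect of the identity
is the negative of the flipped second ASI condition. -/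
theorem coLeibniz (h : IsASISum D s m Δ) (hΔ : ∀ i ∈ s, IsDerHom D (Δ i)) (a b : M) :
    ∑ i ∈ s, coeffwise (Δ i) (commutator D (m i) a b) =
    ∑ i ∈ s, ((tensorRight (L (commutator D (m i)) a) (Δ i b) +
        tensorLeft (L (commutator D (m i)) a) (Δ i b)) -
      reflect (derTensor D) (tensorLeft (L (m i) b) (cocommutator (Δ i) a)) +
      reflect (derTensor D) (tensorRight (L (m i) b) (cocommutator (Δ i) a)) -
      reflect (derTensor D) (tensorRight (L (commutator D (m i)) b) (cocommutator (Δ i) a))) := by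
  rw [← sub_eq_zero]
  have e2 := h.compat₂_flip a b
  simp only [commutator_apply, L_commutator, tensorRight_sub, tensorLeft_sub, cocommutator_apply,
    map_sub, Finset.sum_sub_distrib, Finset.sum_add_distrib,
    h.compat₁_expanded, h.compat₁_opposite hΔ]
  refine Eq.trans ?_ (neg_eq_zero.2 e2)
  abel

end IsASISum

end Bialgebra

open Finset (range)
open Finset.HasAntidiagonal (antidiagonal)

/-! ### Expansions in powers of `h` modulo `h^N` -/

section Expansion

variable {k : Type*} [Field k]

variable (k) in
/-- A `k⟦h⟧`-module `Y` in which the elements `∑ hⁱ vᵢ` with `vᵢ` in the `k`-space `V` make sense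
and in which their coefficients `vₙ` with `n < N` can be recovered. -/
structure Expansion (N : ℕ) (V Y : Type*) [AddCommGroup V] [Module k V] [AddCommGroup Y]
    [Module k⟦X⟧ Y] where
  /-- the inclusion of the constants -/
  incl : V →+ Y
  /-- the coefficients -/
  coeff : ℕ → Y →+ V
  incl_smul : ∀ (c : k) (v : V), incl (c • v) = PowerSeries.C c • incl v
  coeff_smul : ∀ n < N, ∀ (r : k⟦X⟧) (y : Y), coeff n (r • y) =
    ∑ p ∈ antidiagonal n, PowerSeries.coeff p.1 r • coeff p.2 y
  coeff_incl : ∀ n < N, ∀ v, coeff n (incl v) = if n = 0 then v else 0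

variable {N : ℕ} {V V' Y Y' : Type*} [AddCommGroup V] [Module k V] [AddCommGroup Y]
    [Module k⟦X⟧ Y] [AddCommGroup V'] [Module k V'] [AddCommGroup Y'] [Module k⟦X⟧ Y']

/-- Both sides run over the triples of sum `n`. This regrouping is what makes the tensor
coefficients balanced over `k⟦X⟧`. -/
theorem sum_antidiagonal_rotate (n : ℕ) (F : ℕ → ℕ → ℕ → V) :
    ∑ p ∈ antidiagonal n, ∑ q ∈ antidiagonal p.1, F q.1 q.2 p.2 =
      ∑ p ∈ antidiagonal n, ∑ q ∈ antidiagonal p.2, F p.1 q.1 q.2 := by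
  simp only [Finset.sum_sigma']
  refine Finset.sum_nbij' (fun x => ⟨(x.2.1, x.2.2 + x.1.2), (x.2.2, x.1.2)⟩)
    (fun x => ⟨(x.1.1 + x.2.1, x.2.2), (x.1.1, x.2.1)⟩) ?_ ?_ ?_ ?_ ?_
  all_goals
    rintro ⟨⟨p, q⟩, ⟨r, s⟩⟩ h
    simp only [Finset.mem_sigma, Finset.HasAntidiagonal.mem_antidiagonal] at h
    obtain ⟨h1, h2⟩ := h
    subst h1 h2
    simp [Finset.HasAntidiagonal.mem_antidiagonal, add_assoc]

theorem sum_antidiagonal_swap (n : ℕ) (F : ℕ → ℕ → ℕ → V) :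
    ∑ p ∈ antidiagonal n, ∑ q ∈ antidiagonal p.2, F q.1 p.1 q.2 =
      ∑ p ∈ antidiagonal n, ∑ q ∈ antidiagonal p.2, F p.1 q.1 q.2 := by
  rw [← sum_antidiagonal_rotate, ← sum_antidiagonal_rotate n fun s t u => F t s u]
  exact Finset.sum_congr rfl fun p _ => Finset.Nat.sum_antidiagonal_swap (f := fun q => F q.1 q.2 p.2)

namespace Expansion

/-- `∑ hⁱ xᵢ` for `i < N`. -/
noncomputable def sum (e : Expansion k N V Y) (x : ℕ → V) : Y :=
  ∑ i ∈ range N, (PowerSeries.X : k⟦X⟧) ^ i • e.incl (x i)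

/-- `∑ hⁱ⁺ʲ xᵢⱼ` for `i, j < N`. -/
noncomputable def sum₂ (e : Expansion k N V Y) (x : ℕ → ℕ → V) : Y :=
  ∑ j ∈ range N, (PowerSeries.X : k⟦X⟧) ^ j • e.sum fun i => x i j

theorem sum_add (e : Expansion k N V Y) (x y : ℕ → V) :
    e.sum x + e.sum y = e.sum fun i => x i + y i := by
  simp [sum, Finset.sum_add_distrib]

theorem neg_sum (e : Expansion k N V Y) (x : ℕ → V) :
    -e.sum x = e.sum fun i => -x i := by
  simp [sum]

theorem sum₂_add (e : Expansion k N V Y) (x y : ℕ → ℕ → V) :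
    e.sum₂ x + e.sum₂ y = e.sum₂ fun i j => x i j + y i j := by
  simp [sum₂, ← sum_add, Finset.sum_add_distrib]

theorem sum₂_sub (e : Expansion k N V Y) (x y : ℕ → ℕ → V) :
    e.sum₂ x - e.sum₂ y = e.sum₂ fun i j => x i j - y i j := by
  rw [sub_eq_iff_eq_add, sum₂_add]
  simp

theorem coeff_X_pow_smul (e : Expansion k N V Y) {n : ℕ} (hn : n < N) (i : ℕ) (y : Y) :
    e.coeff n ((PowerSeries.X : k⟦X⟧) ^ i • y) = if i ≤ n then e.coeff (n - i) y else 0 := by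
  rw [e.coeff_smul n hn]
  simp only [PowerSeries.coeff_X_pow, ite_smul, one_smul, zero_smul]
  split_ifs with h
  · rw [Finset.sum_eq_single (i, n - i)]
    · simp
    · rintro ⟨p, q⟩ hp hne
      simp only [Finset.HasAntidiagonal.mem_antidiagonal] at hp
      exact if_neg fun hpi => hne (by rw [Prod.mk.injEq]; omega)
    · intro hni
      exact absurd (Finset.HasAntidiagonal.mem_antidiagonal.2 (by simp; omega)) hni
  · refine Finset.sum_eq_zero fun p hp => if_neg ?_
    have := Finset.HasAntidiagonal.mem_antidiagonal.1 hp
    omega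

theorem coeff_sum (e : Expansion k N V Y) {n : ℕ} (hn : n < N) (x : ℕ → V) :
    e.coeff n (e.sum x) = x n := by
  rw [sum, map_sum, Finset.sum_eq_single n]
  · rw [e.coeff_X_pow_smul hn, if_pos le_rfl, e.coeff_incl _ (by omega)]
    simp
  · intro i _ hi
    rw [e.coeff_X_pow_smul hn]
    split_ifs with h
    · rw [e.coeff_incl _ (by omega), if_neg (by omega)]
    · rfl
  · intro h
    exact absurd (Finset.mem_range.2 hn) h

theorem coeff_sum₂ (e : Expansion k N V Y) {n : ℕ} (hn : n < N) (x : ℕ → ℕ → V) :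
    e.coeff n (e.sum₂ x) = ∑ p ∈ antidiagonal n, x p.1 p.2 := by
  -- The outer sum of `sum₂` runs over the second index, so the antidiagonal is parametrised by that
  -- index.
  rw [← Finset.Nat.sum_antidiagonal_swap,
    Finset.Nat.sum_antidiagonal_eq_sum_range_succ_mk, sum₂, map_sum]
  have hsub : range n.succ ⊆ range N := Finset.range_subset_range.2 hn
  rw [← Finset.sum_subset hsub]
  · refine Finset.sum_congr rfl fun j hj => ?_
    rw [e.coeff_X_pow_smul hn, if_pos (by simp at hj; omega), e.coeff_sum (by omega)]
    rfl
  · intro j _ hj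
    rw [e.coeff_X_pow_smul hn, if_neg (by simp at hj; omega)]

/-- Polynomials with coefficients in `Y`. -/
noncomputable def poly (e : Expansion k N V Y) : Expansion k N (Poly V) (Poly Y) where
  incl := Finsupp.mapRange.addMonoidHom e.incl
  coeff n := Finsupp.mapRange.addMonoidHom (e.coeff n)
  incl_smul c v := by ext j; simp [e.incl_smul]
  coeff_smul n hn r y := by
    ext j
    simp [e.coeff_smul n hn, Finsupp.finsetSum_apply]
  coeff_incl n hn v := by
    ext j
    simp only [Finsupp.mapRange.addMonoidHom_apply, Finsupp.mapRange_apply, e.coeff_incl n hn]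
    split_ifs <;> rfl

@[simp]
theorem poly_incl_apply (e : Expansion k N V Y) (p : Poly V) (j : ℕ) :
    e.poly.incl p j = e.incl (p j) := rfl

@[simp]
theorem poly_incl_single (e : Expansion k N V Y) (v : V) (j : ℕ) :
    e.poly.incl (Finsupp.single j v) = Finsupp.single j (e.incl v) := by
  simp [poly]

theorem poly_sum_apply (e : Expansion k N V Y) (x : ℕ → Poly V) (j : ℕ) :
    e.poly.sum x j = e.sum fun i => x i j := by
  simp [sum, Finsupp.finsetSum_apply]

/-- The coefficient of `hⁿ` on a tensor product. -/
theorem exists_tensorCoeff (e : Expansion k N V Y) (e' : Expansion k N V' Y') (n : ℕ) :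
    ∃ c : Y ⊗[k⟦X⟧] Y' →+ V ⊗[k] V', n < N → ∀ y y', c (y ⊗ₜ y') =
      ∑ p ∈ antidiagonal n, e.coeff p.1 y ⊗ₜ e'.coeff p.2 y' := by
  -- Coefficients are compatible with scalars only below `N`; beyond that the value `0` is a
  -- harmless default.
  by_cases hn : n < N
  swap
  · exact ⟨0, fun h => absurd h hn⟩
  let f : Y →+ Y' →+ V ⊗[k] V' := AddMonoidHom.mk' (fun y => AddMonoidHom.mk'
    (fun y' => ∑ p ∈ antidiagonal n, e.coeff p.1 y ⊗ₜ e'.coeff p.2 y')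
    fun a b => by simp [TensorProduct.tmul_add, Finset.sum_add_distrib])
    fun a b => by
      ext y'
      simp [TensorProduct.add_tmul, Finset.sum_add_distrib]
  -- Descent to the tensor product over `k⟦X⟧`: letting `r` act on either factor gives the same sum
  -- over triples of indices.
  refine ⟨TensorProduct.liftAddHom f fun r y y' => ?_, fun _ y y' => rfl⟩
  simp only [f, AddMonoidHom.mk'_apply]
  trans ∑ p ∈ antidiagonal n, ∑ q ∈ antidiagonal p.2,
    PowerSeries.coeff p.1 r • (e.coeff q.1 y ⊗ₜ[k] e'.coeff q.2 y')
  · rw [← sum_antidiagonal_rotate n fun s t u =>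
      PowerSeries.coeff s r • (e.coeff t y ⊗ₜ[k] e'.coeff u y')]
    refine Finset.sum_congr rfl fun p hp => ?_
    have := Finset.HasAntidiagonal.mem_antidiagonal.1 hp
    rw [e.coeff_smul _ (by omega), TensorProduct.sum_tmul]
    rfl
  · rw [← sum_antidiagonal_swap n fun s t u =>
      PowerSeries.coeff s r • (e.coeff t y ⊗ₜ[k] e'.coeff u y')]
    refine Finset.sum_congr rfl fun p hp => ?_
    have := Finset.HasAntidiagonal.mem_antidiagonal.1 hp
    rw [e'.coeff_smul _ (by omega), TensorProduct.tmul_sum]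
    simp

/-- Tensor products. -/
noncomputable def tensor (e : Expansion k N V Y) (e' : Expansion k N V' Y') :
    Expansion k N (V ⊗[k] V') (Y ⊗[k⟦X⟧] Y') where
  incl := TensorProduct.liftAddHom
    (AddMonoidHom.mk' (fun v => AddMonoidHom.mk' (fun v' => e.incl v ⊗ₜ e'.incl v')
      fun a b => by simp [TensorProduct.tmul_add])
      fun a b => by
        ext y'
        simp [TensorProduct.add_tmul])
    fun c v v' => by
      simp [e.incl_smul, e'.incl_smul, TensorProduct.smul_tmul']
  coeff n := (exists_tensorCoeff e e' n).choose
  incl_smul c x := by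
    induction x using TensorProduct.induction_on with
    | zero => simp
    | add x y hx hy => simp only [smul_add, map_add, hx, hy]
    | tmul v v' => simp [TensorProduct.smul_tmul', e.incl_smul]
  coeff_smul n hn r x := by
    induction x using TensorProduct.induction_on with
    | zero => simp
    | add x y hx hy => simp only [smul_add, map_add, hx, hy, Finset.sum_add_distrib]
    | tmul y y' =>
      rw [TensorProduct.smul_tmul', (exists_tensorCoeff e e' n).choose_spec hn]
      trans ∑ p ∈ antidiagonal n, ∑ q ∈ antidiagonal p.2,
        PowerSeries.coeff p.1 r • (e.coeff q.1 y ⊗ₜ[k] e'.coeff q.2 y')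
      · rw [← sum_antidiagonal_rotate n fun s t u =>
          PowerSeries.coeff s r • (e.coeff t y ⊗ₜ[k] e'.coeff u y')]
        refine Finset.sum_congr rfl fun p hp => ?_
        have := Finset.HasAntidiagonal.mem_antidiagonal.1 hp
        rw [e.coeff_smul _ (by omega), TensorProduct.sum_tmul]
        rfl
      · refine Finset.sum_congr rfl fun p hp => ?_
        have := Finset.HasAntidiagonal.mem_antidiagonal.1 hp
        rw [(exists_tensorCoeff e e' p.2).choose_spec (by omega), Finset.smul_sum]
  coeff_incl n hn x := by
    induction x using TensorProduct.induction_on with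
    | zero => simp
    | add x y hx hy =>
      rw [map_add, map_add, hx, hy]
      split_ifs <;> simp
    | tmul v v' =>
      simp only [TensorProduct.liftAddHom_tmul, AddMonoidHom.mk'_apply]
      rw [(exists_tensorCoeff e e' n).choose_spec hn]
      split_ifs with h
      · subst h
        simp [e.coeff_incl _ hn, e'.coeff_incl _ hn]
      · refine Finset.sum_eq_zero fun p hp => ?_
        have := Finset.HasAntidiagonal.mem_antidiagonal.1 hp
        rw [e.coeff_incl _ (by omega), e'.coeff_incl _ (by omega)]
        split_ifs
        · omega
        all_goals simp

@[simp]
theorem tensor_incl_tmul (e : Expansion k N V Y) (e' : Expansion k N V' Y') (v : V) (v' : V') :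
    (e.tensor e').incl (v ⊗ₜ v') = e.incl v ⊗ₜ e'.incl v' := rfl

theorem tensor_sum_tmul (e : Expansion k N V Y) (e' : Expansion k N V' Y') (x : ℕ → V) (v' : V') :
    (e.tensor e').sum (fun i => x i ⊗ₜ v') = e.sum x ⊗ₜ e'.incl v' := by
  simp [sum, TensorProduct.sum_tmul, TensorProduct.smul_tmul']

theorem tensor_tmul_sum (e : Expansion k N V Y) (e' : Expansion k N V' Y') (v : V) (x : ℕ → V') :
    (e.tensor e').sum (fun i => v ⊗ₜ x i) = e.incl v ⊗ₜ e'.sum x := by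
  simp [sum, TensorProduct.tmul_sum]

/-! ### Maps over `k⟦X⟧` expanded in powers of `h` -/

section Naturality

variable (e : Expansion k N V Y) (e' : Expansion k N V' Y')

/-- The `k⟦h⟧`-linear map `G` extends the `k`-linear map `g`. -/
def Extends (G : Y →ₗ[k⟦X⟧] Y') (g : V →ₗ[k] V') : Prop :=
  ∀ v, G (e.incl v) = e'.incl (g v)

/-- The `k⟦h⟧`-linear map `G` restricts to `∑ gᵢ hⁱ` on `V`. -/
def ExtendsSum (G : Y →ₗ[k⟦X⟧] Y') (g : ℕ → V →ₗ[k] V') : Prop :=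
  ∀ v, G (e.incl v) = e'.sum fun i => g i v

variable {e e'}
variable {V'' Y'' : Type*} [AddCommGroup V''] [Module k V''] [AddCommGroup Y''] [Module k⟦X⟧ Y'']
  {e'' : Expansion k N V'' Y''}

theorem Extends.sum {G : Y →ₗ[k⟦X⟧] Y'} {g : V →ₗ[k] V'} (h : Extends e e' G g) (x : ℕ → V) :
    G (e.sum x) = e'.sum fun i => g (x i) := by
  simp [Expansion.sum, h _]

theorem Extends.sum₂ {G : Y →ₗ[k⟦X⟧] Y'} {g : V →ₗ[k] V'} (h : Extends e e' G g)
    (x : ℕ → ℕ → V) : G (e.sum₂ x) = e'.sum₂ fun i j => g (x i j) := by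
  simp [Expansion.sum₂, h.sum]

/-- The source of all double sums: a deformed map applied to a deformed value. The first index
belongs to the outer map, the second to the inner value. -/
theorem ExtendsSum.sum {G : Y →ₗ[k⟦X⟧] Y'} {g : ℕ → V →ₗ[k] V'} (h : ExtendsSum e e' G g)
    (x : ℕ → V) : G (e.sum x) = e'.sum₂ fun i j => g i (x j) := by
  simp [Expansion.sum, Expansion.sum₂, h _]

theorem Extends.comp {G : Y →ₗ[k⟦X⟧] Y'} {g : V →ₗ[k] V'} {H : Y' →ₗ[k⟦X⟧] Y''}
    {t : V' →ₗ[k] V''} (hH : Extends e' e'' H t) (hG : Extends e e' G g) :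
    Extends e e'' (H ∘ₗ G) (t ∘ₗ g) := fun v => by
  rw [LinearMap.comp_apply, hG v, hH]
  rfl

theorem Extends.add {G H : Y →ₗ[k⟦X⟧] Y'} {g t : V →ₗ[k] V'} (hG : Extends e e' G g)
    (hH : Extends e e' H t) : Extends e e' (G + H) (g + t) := fun v => by
  simp [hG v, hH v]

theorem Extends.neg {G : Y →ₗ[k⟦X⟧] Y'} {g : V →ₗ[k] V'} (hG : Extends e e' G g) :
    Extends e e' (-G) (-g) := fun v => by
  simp [hG v]

theorem Extends.sub {G H : Y →ₗ[k⟦X⟧] Y'} {g t : V →ₗ[k] V'} (hG : Extends e e' G g)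
    (hH : Extends e e' H t) : Extends e e' (G - H) (g - t) := fun v => by
  simp [hG v, hH v]

theorem Extends.pow {G : Module.End k⟦X⟧ Y} {g : Module.End k V} (h : Extends e e G g) (n : ℕ) :
    Extends e e (G ^ n) (g ^ n) := by
  induction n with
  | zero => exact fun v => rfl
  | succ n ih =>
    rw [pow_succ, pow_succ]
    exact ih.comp h

theorem ExtendsSum.comp_extends {G : Y →ₗ[k⟦X⟧] Y'} {g : ℕ → V →ₗ[k] V'}
    {H : Y' →ₗ[k⟦X⟧] Y''} {t : V' →ₗ[k] V''} (hG : ExtendsSum e e' G g)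
    (hH : Extends e' e'' H t) : ExtendsSum e e'' (H ∘ₗ G) (fun i => t ∘ₗ g i) := fun v => by
  rw [LinearMap.comp_apply, hG v, hH.sum]
  rfl

theorem Extends.const : Extends e e.poly (const k⟦X⟧ Y) (const k V) := fun v => by
  simp [Conformal.const]

theorem Extends.lam : Extends e.poly e.poly (lam k⟦X⟧ Y) (lam k V) := fun p => by
  induction p using Finsupp.induction_linear with
  | zero => simp
  | add p q hp hq => simp only [map_add, hp, hq]
  | single n v => simp

theorem Extends.coeffwise {G : Y →ₗ[k⟦X⟧] Y'} {g : V →ₗ[k] V'} (h : Extends e e' G g) :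
    Extends e.poly e'.poly (coeffwise G) (coeffwise g) := fun p => by
  ext j
  simp [h _]

theorem ExtendsSum.coeffwise {G : Y →ₗ[k⟦X⟧] Y'} {g : ℕ → V →ₗ[k] V'} (h : ExtendsSum e e' G g) :
    ExtendsSum e.poly e'.poly (coeffwise G) (fun i => coeffwise (g i)) := fun p => by
  ext j
  simp [h _, poly_sum_apply]

theorem ExtendsSum.subst {G : Y →ₗ[k⟦X⟧] Y'} {g : ℕ → V →ₗ[k] V'} (h : ExtendsSum e e' G g)
    {S : Module.End k⟦X⟧ Y'} {T : Module.End k V'} (hS : Extends e' e' S T) :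
    ExtendsSum e.poly e' (subst G S) (fun i => subst (g i) T) := fun p => by
  induction p using Finsupp.induction_linear with
  | zero => simp [Expansion.sum]
  | add p q hp hq => simp only [map_add, hp, hq, sum_add]
  | single n v => simp [h v, (hS.pow n).sum]

theorem Extends.subst {G : Y →ₗ[k⟦X⟧] Y'} {g : V →ₗ[k] V'} (h : Extends e e' G g)
    {S : Module.End k⟦X⟧ Y'} {T : Module.End k V'} (hS : Extends e' e' S T) :
    Extends e.poly e' (subst G S) (subst g T) := fun p => by
  induction p using Finsupp.induction_linear with
  | zero => simp
  | add p q hp hq => simp only [map_add, hp, hq]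
  | single n v => simp [h v, hS.pow n _]

theorem Extends.reflect {G : Module.End k⟦X⟧ Y} {g : Module.End k V} (h : Extends e e G g) :
    Extends e.poly e.poly (reflect G) (reflect g) :=
  Extends.const.subst (Extends.lam.neg.sub h.coeffwise)

theorem Extends.const₂ : Extends e e.poly.poly (const₂ k⟦X⟧ Y) (const₂ k V) :=
  Extends.const.comp Extends.const

theorem Extends.lam₂ : Extends e.poly.poly e.poly.poly (lam₂ k⟦X⟧ Y) (lam₂ k V) :=
  Extends.lam.coeffwise

theorem Extends.mu₂ : Extends e.poly.poly e.poly.poly (mu₂ k⟦X⟧ Y) (mu₂ k V) :=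
  Extends.lam

theorem Extends.derTensor {G : Module.End k⟦X⟧ Y} {g : Module.End k V} (h : Extends e e G g) :
    Extends (e.tensor e) (e.tensor e) (derTensor G) (derTensor g) := fun x => by
  induction x using TensorProduct.induction_on with
  | zero => simp
  | add x y hx hy => simp only [map_add, hx, hy]
  | tmul a b => simp [h _]

theorem Extends.flip : Extends (e.tensor e) (e.tensor e) (flip k⟦X⟧ Y) (flip k V) := fun x => by
  induction x using TensorProduct.induction_on with
  | zero => simp
  | add x y hx hy => simp only [map_add, hx, hy]
  | tmul a b => simp

theorem ExtendsSum.tensorRight {G : Y →ₗ[k⟦X⟧] Poly Y} {g : ℕ → V →ₗ[k] Poly V}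
    (h : ExtendsSum e e.poly G g) :
    ExtendsSum (e.tensor e) (e.tensor e).poly (tensorRight G) fun i => tensorRight (g i) :=
  fun x => by
  induction x using TensorProduct.induction_on with
  | zero => simp [Expansion.sum]
  | add x y hx hy => simp only [map_add, hx, hy, sum_add]
  | tmul a b =>
    ext j
    simp [poly_sum_apply, tensorRight_tmul_apply, h a, tensor_sum_tmul]

theorem ExtendsSum.tensorLeft {G : Y →ₗ[k⟦X⟧] Poly Y} {g : ℕ → V →ₗ[k] Poly V}
    (h : ExtendsSum e e.poly G g) :
    ExtendsSum (e.tensor e) (e.tensor e).poly (tensorLeft G) fun i => tensorLeft (g i) :=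
  fun x => by
  induction x using TensorProduct.induction_on with
  | zero => simp [Expansion.sum]
  | add x y hx hy => simp only [map_add, hx, hy, sum_add]
  | tmul a b =>
    ext j
    simp [poly_sum_apply, tensorLeft_tmul_apply, h b, tensor_tmul_sum]

theorem ExtendsSum.lTensor {G : Y →ₗ[k⟦X⟧] Y ⊗[k⟦X⟧] Y} {g : ℕ → V →ₗ[k] V ⊗[k] V}
    (h : ExtendsSum e (e.tensor e) G g) :
    ExtendsSum (e.tensor e) (e.tensor (e.tensor e)) (G.lTensor Y) fun i => (g i).lTensor V :=
  fun x => by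
  induction x using TensorProduct.induction_on with
  | zero => simp [Expansion.sum]
  | add x y hx hy => simp only [map_add, hx, hy, sum_add]
  | tmul a b => simp [h b, tensor_tmul_sum]

theorem ExtendsSum.rTensor {G : Y →ₗ[k⟦X⟧] Y ⊗[k⟦X⟧] Y} {g : ℕ → V →ₗ[k] V ⊗[k] V}
    (h : ExtendsSum e (e.tensor e) G g) :
    ExtendsSum (e.tensor e) ((e.tensor e).tensor e) (G.rTensor Y) fun i => (g i).rTensor V :=
  fun x => by
  induction x using TensorProduct.induction_on with
  | zero => simp [Expansion.sum]
  | add x y hx hy => simp only [map_add, hx, hy, sum_add]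
  | tmul a b => simp [h a, tensor_sum_tmul]

theorem Extends.assoc : Extends ((e.tensor e).tensor e) (e.tensor (e.tensor e))
    (TensorProduct.assoc k⟦X⟧ Y Y Y).toLinearMap (TensorProduct.assoc k V V V).toLinearMap :=
  fun x => by
  induction x using TensorProduct.induction_on with
  | zero => simp
  | add x y hx hy => simp only [map_add, hx, hy]
  | tmul x c =>
    induction x using TensorProduct.induction_on with
    | zero => simp
    | add x y hx hy => simp only [map_add, TensorProduct.add_tmul, hx, hy]
    | tmul a b => simp

end Naturality

/-! ### Comparing coefficients of `hⁿ` in the axioms -/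

section Reduction

variable {e : Expansion k N V Y} {mY : LambdaProduct k⟦X⟧ Y} {m : ℕ → LambdaProduct k V}
  {ΔY : Y →ₗ[k⟦X⟧] Y ⊗[k⟦X⟧] Y} {Δ : ℕ → V →ₗ[k] V ⊗[k] V}
  {DY : Module.End k⟦X⟧ Y} {D : Module.End k V}

variable (e mY m) in
/-- `a_λ b = ∑ hⁱ mᵢ(a, b)` for constants `a` and `b`. -/
def ExtendsProduct : Prop := ∀ a, ExtendsSum e e.poly (mY (e.incl a)) fun i => m i a

theorem ExtendsProduct.flip (h : ExtendsProduct e mY m) (b : V) :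
    ExtendsSum e e.poly (mY.flip (e.incl b)) fun i => (m i).flip b :=
  fun a => h a b

theorem ExtendsProduct.isSesquilinear (h : ExtendsProduct e mY m) (hD : Extends e e DY D)
    (hY : IsSesquilinear DY mY) {n : ℕ} (hn : n < N) : IsSesquilinear D (m n) where
  left a b := by
    have := hY.left (e.incl a) (e.incl b)
    rw [hD a, h _ b, h a b, Extends.lam.sum, neg_sum] at this
    simpa only [coeff_sum _ hn] using congrArg (e.poly.coeff n) this
  right a b := by
    have := hY.right (e.incl a) (e.incl b)
    rw [hD b, h a _, h a b, (hD.coeffwise.add Extends.lam).sum] at this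
    simpa only [coeff_sum _ hn] using congrArg (e.poly.coeff n) this

/-- Both nestings of constants are double sums in powers of `h`, and the coefficient of such a sum
at `hⁿ` runs over the antidiagonal of `n`. -/
theorem ExtendsProduct.isAssocSum (h : ExtendsProduct e mY m)
    (hY : ∀ a b c, leftNested mY mY a b c = rightNested mY mY a b c) {n : ℕ} (hn : n < N) :
    IsAssocSum (antidiagonal n) (fun p => m p.1) (fun p => m p.2) := fun a b c => by
  have hl : leftNested mY mY (e.incl a) (e.incl b) (e.incl c) =
      e.poly.poly.sum₂ fun i j => leftNested (m i) (m j) a b c := by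
    rw [leftNested, h a b]
    exact (((h.flip c).comp_extends
      (Extends.const₂.subst (Extends.lam₂.add Extends.mu₂))).subst Extends.lam₂).sum _
  have hr : rightNested mY mY (e.incl a) (e.incl b) (e.incl c) =
      e.poly.poly.sum₂ fun i j => rightNested (m i) (m j) a b c := by
    rw [rightNested, h b c]
    exact (((h a).comp_extends (Extends.const₂.subst Extends.lam₂)).subst Extends.mu₂).sum _
  have := hY (e.incl a) (e.incl b) (e.incl c)
  rw [hl, hr] at this
  simpa only [coeff_sum₂ _ hn] using congrArg (e.poly.poly.coeff n) this

theorem ExtendsSum.isCoassocSum (h : ExtendsSum e (e.tensor e) ΔY Δ)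
    (hY : ∀ a, coRight ΔY ΔY a = coLeft ΔY ΔY a) {n : ℕ} (hn : n < N) :
    IsCoassocSum (antidiagonal n) (fun p => Δ p.1) (fun p => Δ p.2) := fun a => by
  have hl : coLeft ΔY ΔY (e.incl a) =
      (e.tensor (e.tensor e)).sum₂ fun i j => coLeft (Δ i) (Δ j) a := by
    rw [coLeft, LinearMap.comp_apply, LinearMap.comp_apply, h a, h.rTensor.sum, Extends.assoc.sum₂]
    rfl
  have hr : coRight ΔY ΔY (e.incl a) =
      (e.tensor (e.tensor e)).sum₂ fun i j => coRight (Δ i) (Δ j) a := by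
    rw [coRight, LinearMap.comp_apply, h a, h.lTensor.sum]
    rfl
  have := hY (e.incl a)
  rw [hl, hr] at this
  simpa only [coeff_sum₂ _ hn] using congrArg ((e.tensor (e.tensor e)).coeff n) this

theorem sum₂_swap (x : ℕ → ℕ → V) : e.sum₂ x = e.sum₂ fun i j => x j i := by
  simp only [sum₂, sum, Finset.smul_sum]
  rw [Finset.sum_comm]
  simp only [smul_smul, mul_comm]

theorem ExtendsProduct.opposite (h : ExtendsProduct e mY m) (hD : Extends e e DY D) :
    ExtendsProduct e (opposite DY mY) fun i => opposite D (m i) := fun a b => by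
  rw [opposite_apply, h b a, hD.reflect.sum]
  rfl

theorem ExtendsProduct.isASISum (h : ExtendsProduct e mY m) (hD : Extends e e DY D)
    (hΔ : ExtendsSum e (e.tensor e) ΔY Δ) (hY : IsASIBialgebra DY mY ΔY) {n : ℕ} (hn : n < N) :
    IsASISum D (antidiagonal n) (fun p => m p.1) (fun p => Δ p.2) where
  compat₁ a b := by
    have := hY.compat₁ (e.incl a) (e.incl b)
    have hL := (h a).tensorLeft.sum fun j => Δ j b
    have hR := ((h.opposite hD b).tensorRight.comp_extends hD.derTensor.reflect).sum fun j => Δ j a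
    rw [← hΔ b] at hL
    rw [← hΔ a] at hR
    simp only [LinearMap.comp_apply] at hR
    simp only [L, Rt] at this
    -- On the left the coproduct is the outer map, so its index comes first; `sum₂_swap` restores
    -- the order in which the product has the first index.
    rw [hL, hR, sum₂_add, h a b, hΔ.coeffwise.sum, sum₂_swap] at this
    simpa only [coeff_sum₂ _ hn, L, Rt] using congrArg ((e.tensor e).poly.coeff n) this
  compat₂ a b := by
    have := hY.compat₂ (e.incl a) (e.incl b)
    have h1 := (h b).tensorRight.sum fun j => Δ j a
    have h2 := (h.opposite hD b).tensorLeft.sum fun j => Δ j a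
    have h3 := (h a).tensorRight.sum fun j => Δ j b
    have h4 := (h.opposite hD a).tensorLeft.sum fun j => Δ j b
    rw [← hΔ a] at h1 h2
    rw [← hΔ b] at h3 h4
    simp only [L, Rt] at this
    rw [h1, h2, h3, h4, sum₂_sub, sum₂_sub, hD.derTensor.reflect.sum₂,
      Extends.flip.coeffwise.sum₂, sum₂_add] at this
    simpa only [coeff_sum₂ _ hn, map_zero, L, Rt] using congrArg ((e.tensor e).poly.coeff n) this

end Reduction

end Expansion

end Expansion

/-! ### The quotients `V[[h]] / h^N V[[h]]` -/

section FormalSeries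

variable {k : Type*} [Field k] {V : Type*} [AddCommGroup V] [Module k V]

namespace FormalSeries

theorem coeff_X_pow_smul (i n : ℕ) (v : FormalSeries V) :
    coeff n ((PowerSeries.X : k⟦X⟧) ^ i • v) = if i ≤ n then coeff (n - i) v else 0 := by
  rw [coeff_smul]
  simp only [PowerSeries.coeff_X_pow, ite_smul, one_smul, zero_smul]
  split_ifs with h
  · rw [Finset.sum_eq_single (i, n - i)]
    · simp
    · rintro ⟨p, q⟩ hp hne
      simp only [Finset.HasAntidiagonal.mem_antidiagonal] at hp
      exact if_neg fun hpi => hne (by rw [Prod.mk.injEq]; omega)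
    · intro hni
      exact absurd (Finset.HasAntidiagonal.mem_antidiagonal.2 (by simp; omega)) hni
  · refine Finset.sum_eq_zero fun p hp => if_neg ?_
    have := Finset.HasAntidiagonal.mem_antidiagonal.1 hp
    omega

/-- The coefficient of `hⁿ` as an additive map. -/
def coeffHom (V : Type*) [AddCommGroup V] (n : ℕ) : FormalSeries V →+ V where
  toFun := coeff n
  map_zero' := coeff_zero n
  map_add' v w := coeff_add v w n

@[simp]
theorem coeffHom_apply (n : ℕ) (v : FormalSeries V) : coeffHom V n v = coeff n v := rfl

theorem coeff_incl (n : ℕ) (v : V) : coeff n (incl k V v) = if n = 0 then v else 0 := by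
  exact Pi.single_apply (M := V) 0 v n

theorem mem_hIdeal_pow_smul_top {N : ℕ} {v : FormalSeries V} :
    v ∈ ((hIdeal k) ^ N • ⊤ : Submodule k⟦X⟧ (FormalSeries V)) ↔ ∀ n < N, coeff n v = 0 := by
  rw [Ideal.span_singleton_pow, Submodule.ideal_span_singleton_smul,
    Submodule.mem_smul_pointwise_iff_exists]
  constructor
  · rintro ⟨w, _, rfl⟩ n hn
    rw [coeff_X_pow_smul, if_neg (by omega)]
  · intro h
    -- Division by `h^N` is a shift of the coefficients.
    refine ⟨mk fun i => coeff (i + N) v, trivial, ext fun n => ?_⟩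
    rw [coeff_X_pow_smul, coeff_mk]
    split_ifs with hn
    · rw [Nat.sub_add_cancel hn]
    · exact (h n (by omega)).symm

theorem exists_quotCoeff (N n : ℕ) : ∃ c : Quot k (FormalSeries V) N →+ V,
    n < N → ∀ v, c (quotMk k _ N v) = coeff n v := by
  by_cases hn : n < N
  swap
  · exact ⟨0, fun h => absurd h hn⟩
  refine ⟨QuotientAddGroup.lift
    ((hIdeal k) ^ N • ⊤ : Submodule k⟦X⟧ (FormalSeries V)).toAddSubgroup (coeffHom V n)
    fun v hv => mem_hIdeal_pow_smul_top.1 hv n hn, fun _ v => rfl⟩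

variable (k V) in
/-- The expansion of elements of `V[[h]] / h^N V[[h]]`. -/
noncomputable def expansion (N : ℕ) : Expansion k N V (Quot k (FormalSeries V) N) where
  incl := (quotMk k (FormalSeries V) N).toAddMonoidHom.comp (incl k V).toAddMonoidHom
  coeff n := (exists_quotCoeff N n).choose
  incl_smul c v := by
    simp only [AddMonoidHom.comp_apply, LinearMap.toAddMonoidHom_coe, map_smul]
    rw [← C_smul, map_smul]
  coeff_smul n hn r y := by
    obtain ⟨v, rfl⟩ := Submodule.mkQ_surjective _ y
    rw [← map_smul, (exists_quotCoeff N n).choose_spec hn, FormalSeries.coeff_smul]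
    refine Finset.sum_congr rfl fun p hp => ?_
    have := Finset.HasAntidiagonal.mem_antidiagonal.1 hp
    rw [(exists_quotCoeff N p.2).choose_spec (by omega)]
  coeff_incl n hn v := by
    simp only [AddMonoidHom.comp_apply, LinearMap.toAddMonoidHom_coe]
    rw [(exists_quotCoeff N n).choose_spec hn, coeff_incl]

theorem expansion_incl (N : ℕ) (v : V) :
    (expansion k V N).incl v = quotMk k _ N (incl k V v) := rfl

theorem coeff_sum {I : Type*} (s : Finset I) (v : I → FormalSeries V) (n : ℕ) :
    coeff n (∑ i ∈ s, v i) = ∑ i ∈ s, coeff n (v i) :=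
  map_sum (coeffHom V n) v s

/-- A series differs from its truncation below `N` by a multiple of `h^N`. -/
theorem quotMk_eq_sum (N : ℕ) (v : FormalSeries V) :
    quotMk k _ N v = (expansion k V N).sum fun i => coeff i v := by
  simp only [Expansion.sum, expansion_incl, ← map_smul, ← map_sum]
  rw [← sub_eq_zero, ← map_sub]
  refine (Submodule.Quotient.mk_eq_zero _).2 (mem_hIdeal_pow_smul_top.2 fun n hn => ?_)
  rw [sub_eq_add_neg, ← neg_one_smul k, coeff_add, coeff_csmul, coeff_sum,
    Finset.sum_eq_single n]
  · simp [coeff_X_pow_smul, coeff_incl]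
  · intro i _ hi
    rw [coeff_X_pow_smul, coeff_incl]
    split_ifs
    · omega
    · rfl
    · rfl
  · intro h
    exact absurd (Finset.mem_range.2 hn) h

theorem extends_lift (D : Module.End k V) (N : ℕ) :
    Expansion.Extends (expansion k V N) (expansion k V N) (quotEnd (lift D) N) D := fun v => by
  rw [expansion_incl, expansion_incl]
  refine (Submodule.mapQ_apply _ _ _ _).trans (congrArg (quotMk k _ N) (ext fun n => ?_))
  rw [lift, LinearMap.coe_mk, AddHom.coe_mk, coeff_mk, coeff_incl, coeff_incl]
  split_ifs <;> simp

theorem quotTensor_tensorIncl (N : ℕ) (x : V ⊗[k] V) :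
    quotTensor (FormalSeries V) N (quotMk k _ N (tensorIncl k V x)) =
      ((expansion k V N).tensor (expansion k V N)).incl x := by
  induction x using TensorProduct.induction_on with
  | zero => simp
  | add x y hx hy => simp only [map_add, hx, hy]
  | tmul a b => rfl

end FormalSeries

/-! ### The semi-classical limit -/

namespace FormalDeformation

variable {D : Module.End k V} {m : LambdaProduct k V} {Δ : V →ₗ[k] V ⊗[k] V}
  (F : FormalDeformation D m Δ) {N : ℕ}

theorem extendsProduct {mN : LambdaProduct k⟦X⟧ (Quot k (FormalSeries V) N)}
    (h : IsReduction F.prod N mN) :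
    Expansion.ExtendsProduct (FormalSeries.expansion k V N) mN F.prodCoeff := fun a b => by
  ext j
  rw [FormalSeries.expansion_incl, FormalSeries.expansion_incl, h, FormalSeries.quotMk_eq_sum,
    Expansion.poly_sum_apply]
  simp only [F.prod_eq]

theorem extendsSum_coprod {ΔN : Quot k (FormalSeries V) N →ₗ[k⟦X⟧]
      Quot k (FormalSeries V) N ⊗[k⟦X⟧] Quot k (FormalSeries V) N}
    (h : IsCoReduction F.coprod N ΔN) :
    Expansion.ExtendsSum (FormalSeries.expansion k V N)
      ((FormalSeries.expansion k V N).tensor (FormalSeries.expansion k V N)) ΔN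
      F.coprodCoeff := fun a => by
  rw [FormalSeries.expansion_incl, h, F.coprod_eq]
  simp only [map_sum, map_smul, FormalSeries.quotTensor_tensorIncl]
  rfl

theorem expansion_identities (n : ℕ) :
    IsSesquilinear D (F.prodCoeff n) ∧
    IsAssocSum (antidiagonal n) (fun p => F.prodCoeff p.1) (fun p => F.prodCoeff p.2) ∧
    IsCoassocSum (antidiagonal n) (fun p => F.coprodCoeff p.1) (fun p => F.coprodCoeff p.2) ∧
    IsASISum D (antidiagonal n) (fun p => F.prodCoeff p.1) (fun p => F.coprodCoeff p.2) := by
  -- The coefficient of `hⁿ` is visible only modulo `h^(n+1)`.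
  obtain ⟨mN, ΔN, hm, hΔ, hN⟩ := F.asi.asi (n + 1)
  have h1 := F.extendsProduct hm
  have h2 := F.extendsSum_coprod hΔ
  have hD := FormalSeries.extends_lift D (n + 1)
  have hn := n.lt_succ_self
  exact ⟨h1.isSesquilinear hD hN.assoc.sesquilinear hn, h1.isAssocSum hN.assoc.assoc hn,
    h2.isCoassocSum hN.coassoc.coassoc hn, h1.isASISum hD h2 hN hn⟩

/-- The semi-classical limit of a conformal formal deformation of a commutative and cocommutative
ASI conformal bialgebra is a Poisson conformal bialgebra. -/
theorem isPoissonBialgebra (hP : IsCommCocommASIBialgebra D m Δ) :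
    IsPoissonBialgebra D F.bracket m F.cobracket Δ := by
  -- Order `1` serves the identities mixing the limit operations with `m` or `Δ`, order `2` those
  -- that are quadratic in the bracket and cobracket.
  obtain ⟨hs1, ha1, hc1, hb1⟩ := F.expansion_identities 1
  obtain ⟨-, ha2, hc2, hb2⟩ := F.expansion_identities 2
  have hs : ∀ n, IsSesquilinear D (F.prodCoeff n) := fun n => (F.expansion_identities n).1
  have hom : ∀ n, IsDerHom D (F.coprodCoeff n) := fun n => by
    rcases n with - | n
    · rw [F.coprodCoeff_zero]
      exact hP.asi.coassoc.hom
    · exact F.coprodCoeff_hom _ (by omega)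
  have hbr : F.bracket = commutator D (F.prodCoeff 1) := rfl
  have hcobr : F.cobracket = cocommutator (F.coprodCoeff 1) := rfl
  have m0 := F.prodCoeff_zero
  have Δ0 := F.coprodCoeff_zero
  have br0 := commutator_eq_zero hP.comm
  have cobr0 := cocommutator_eq_zero hP.cocomm
  have lie : IsLieAlgebra D F.bracket :=
    ⟨hbr ▸ hs1.commutator, fun a b => hbr ▸ commutator_skew D _ a b, fun a b c => by
      -- The pairs `(0, 2)` and `(2, 0)` drop out, because each contains the zero commutator of `m`.
      simpa [Finset.Nat.antidiagonal_succ, m0, br0, ← hbr, leftNested_eq, rightNested_eq,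
        rightNestedSwap_eq, nestLeft_zero_left, nestLeft_zero_right, nestRight_zero_left,
        nestRight_zero_right] using ha2.jacobi (fun p _ => hs p.1) a b c⟩
  have colie : IsLieCoalgebra D F.cobracket :=
    ⟨hcobr ▸ (hom 1).cocommutator, fun a => hcobr ▸ cocommutator_skew _ a, fun a => by
      simpa [Finset.Nat.antidiagonal_succ, Δ0, cobr0, ← hcobr, coLeft_zero_left,
        coLeft_zero_right, coRight_zero_left, coRight_zero_right] using hc2.jacobi a⟩
  have tR0 (x : V ⊗[k] V) : tensorRight (0 : V →ₗ[k] Poly V) x = 0 := by simp [tensorRight]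
  have tL0 (x : V ⊗[k] V) : tensorLeft (0 : V →ₗ[k] Poly V) x = 0 := by simp [tensorLeft]
  have c0 (p : Poly V) : coeffwise (0 : V →ₗ[k] V ⊗[k] V) p = 0 := by ext; simp
  have L0 (a : V) : L (0 : LambdaProduct k V) a = 0 := rfl
  refine ⟨⟨lie, hP.asi.assoc, hP.comm, fun a b c => ?_⟩,
    ⟨colie, hP.asi.coassoc, hP.cocomm, fun a => ?_⟩,
    ⟨lie, colie, fun a b => ?_⟩, hP, fun a b => ?_, fun a b => ?_⟩
  · simpa [Finset.Nat.antidiagonal_succ, m0, br0, ← hbr, leftNested_eq, rightNested_eq,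
      rightNestedSwap_eq, nestLeft_zero_right, nestRight_zero_left,
      nestRight_zero_right] using ha1.leibniz (fun p _ => hs p.1) a b c
  · simpa [Finset.Nat.antidiagonal_succ, Δ0, cobr0, ← hcobr, coLeft_zero_left,
      coRight_zero_left, coRight_zero_right] using hc1.leibniz a
  -- The cocommutators stay folded, so that those of index `0` vanish and those of index `1` are
  -- recognised as the cobracket.
  · simpa [Finset.Nat.antidiagonal_succ, m0, Δ0, br0, cobr0, ← hbr, ← hcobr, c0, L0, tR0, tL0,
      -cocommutator_apply] using hb2.cocycle (fun p _ => hom p.2) a b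
  · simpa [Finset.Nat.antidiagonal_succ, m0, Δ0, br0, cobr0, ← hbr, ← hcobr, c0, L0, tR0, tL0,
      -cocommutator_apply, add_assoc] using hb1.leibniz a b
  · have h := hb1.coLeibniz (fun p _ => hom p.2) a b
    simp [Finset.Nat.antidiagonal_succ, m0, Δ0, br0, cobr0, ← hbr, ← hcobr, L0, tR0, tL0,
      -cocommutator_apply] at h
    rw [h]
    abel

end FormalDeformation

end FormalSeries

end Conformal

theorem theorem4p9 {k : Type*} [Field k] [CharZero k] {P : Type*} [AddCommGroup P] [Module k P]
    (D : Module.End k P) (m : Conformal.LambdaProduct k P) (Δ : P →ₗ[k] TensorProduct k P P)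
    (hP : Conformal.IsCommCocommASIBialgebra D m Δ)
    (F : Conformal.FormalDeformation D m Δ) :
    Conformal.IsPoissonBialgebra D F.bracket m F.cobracket Δ := 
  F.isPoissonBialgebra hP
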